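/- Let $\langle u,v\rangle=u^TJv=-u_0v_3-u_3v_0+u_1v_1+u_2v_2$ on $\mathbb R^4$, $\|u\|_J^2=\langle u,u\rangle$, let $O(3,1)=\{\Theta:\Theta^TJ\Theta=J\}$ act linearly on the cone $\{\langle u,u\rangle=0\}$, and use the coordinates ${\bf u}=(u_1,u_2,u_3)$, $u_3\neq0$, $\hat u=(u_1,u_2)^T$ (so $u_0=\|\hat u\|^2/(2u_3)$). Consider smooth curves $u(x)$ in the cone with $u_3\ne 0$ and $\|u'\|_J^2>0$. Put $$k_0=\|u'\|_J,\quad k_1=\frac{\langle u',u''\rangle^2-\|u'\|_J^2\|u''\|_J^2}{2k_0^5},\quad k_2=\frac{\det({\bf u},{\bf u}',{\bf u}''')}{u_3k_0^3}-\frac{3\langle u',u''\rangle\det({\bf u},{\bf u}',{\bf u}'')}{u_3k_0^5},$$ $$A=\frac1{u_3k_0}\begin{pmatrix}u_3u_1'-u_1u_3'&u_3u_2'-u_2u_3'\\u_2u_3'-u_3u_2'&u_3u_1'-u_1u_3'\end{pmatrix},\qquad \xi=\begin{pmatrix}-\dfrac{u_3'}{u_3k_0}\\[2mm]-\dfrac{\det({\bf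 u},{\bf u}',{\bf u}'')}{u_3k_0^3}\end{pmatrix},$$ $$\rho_L=\begin{pmatrix}1&0&0\\\xi&I&0\\\frac12\|\xi\|^2&\xi^T&1\end{pmatrix}\begin{pmatrix}u_3&0&0\\0&A&0\\0&0&u_3^{-1}\end{pmatrix}\begin{pmatrix}1&v^T&\frac12\|v\|^2\\0&I&v\\0&0&1\end{pmatrix},\quad v=-\hat u/u_3,\qquad K_L=\begin{pmatrix}0&-k_0&0&0\\-k_1&0&0&-k_0\\-k_2&0&0&0\\0&-k_1&-k_2&0\end{pmatrix}.$$ Write $\Phi_g$ for the action of $g$ on the cone in the coordinates ${\bf u}$, and $o=e_4=(0,0,0,1)^T$. Then: (1) $\rho_L\in O(3,1)$, it satisfies $\rho_Lu=e_4$, $\rho_Lu'=k_0e_2$ and the third entry of $\rho_Lu''$ is $0$; its Maurer–Cartan matrix is $(\rho_L)_x\rho_L^{-1}=K_L$; and $\Phi_{\rho_L^{-1}}(o)={\bf u}$, $$d\Phi_{\rho_L^{-1}}(o)=\begin{pmatrix}A^{-1}-\hat u\xi^T&\hat u\\-u_3\xi^T&u_3\end{pmatrix}.$$ (2) Let ${\bf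 u}_t=F({\bf u},{\bf u}',\dots,{\bf u}^{(n)})$, with $F$ defined on a set $\mathcal D$ of $n$-jets, be an $O(3,1)$-invariant evolution: $F(g\cdot j)=d\Phi_g(F(j))$ for every $g\in O(3,1)$ and every jet $j\in\mathcal D$ of a curve as above with $g\cdot j\in\mathcal D$ (and $g\cdot j$ again in the coordinate domain $u_3\ne0$). Then there are functions $r_1,r_2,r_3$ of $k_0,k_1,k_2$ and their derivatives of order at most $n$ such that, on all such jets in $\mathcal D$, $${\bf u}_t=d\Phi_{\rho_L^{-1}}(o)\,(r_1,r_2,r_3)^T=\begin{pmatrix}A^{-1}-\hat u\xi^T&\hat u\\-u_3\xi^T&u_3\end{pmatrix}\begin{pmatrix}r_1\\r_2\\r_3\end{pmatrix};$$ if $\mathcal D$ is open and $F$ is smooth on $\mathcal D$, the $r_i$ are smooth functions on the set of values of the invariants and their derivatives on such jets in $\mathcal D$. (3) Let $T$ be an open interval, $X\subseteq\mathbb R$ open, and ${\bf u}(t,x)$ a smooth family, $(t,x)\in T\times X$, of such curves with ${\bf u}_t=d\Phi_{\rho_L^{-1}}(o)(r_1,r_2,r_3)^T$ for some functions $r_i(t,x)$.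 Then the $r_i$ are smooth, $(k_0)_t=r_1'+r_3k_0$, arc-length is preserved ($k_0$ is independent of $t$) if and only if $r_3=-r_1'/k_0$ on $T\times X$, and $$(k_1)_t=\Big(\tfrac1{k_0}(k_1r_1+k_2r_2+r_3')\Big)'-k_1r_3+\tfrac{k_2}{k_0}r_2',$$ $$(k_2)_t=\Big(\tfrac1{k_0}\big[(\tfrac1{k_0}r_2')'+k_2r_1-k_1r_2\big]\Big)'-k_2r_3-\tfrac{k_1}{k_0}r_2'.$$ If arc-length is preserved and $k_0=1$ at some time $t_0 \in T$ (for all $x\in X$), then $k_0=1$ and $r_3=-r_1'$ on $T\times X$, and, with $D=d/dx$, $$\begin{pmatrix}k_1\\k_2\end{pmatrix}_t=P\begin{pmatrix}r_1\\r_2\end{pmatrix},\qquad P=\begin{pmatrix}-D^3+k_1D+Dk_1&Dk_2+k_2D\\Dk_2+k_2D&D^3-Dk_1-k_1D\end{pmatrix}.$$ -/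

import Mathlib

open scoped Matrix ContDiff

noncomputable section

namespace LightCone

/-! ### The Minkowski form, the Lorentz group and the light cone -/

/-- The matrix `J` of the Minkowski form on `ℝ⁴` (coordinates `u₀, u₁, u₂, u₃`). -/
def J : Matrix (Fin 4) (Fin 4) ℝ :=
  !![0, 0, 0, -1; 0, 1, 0, 0; 0, 0, 1, 0; -1, 0, 0, 0]

/-- The Minkowski product `⟨u, v⟩ = uᵀ J v`. -/
def mink (u v : Fin 4 → ℝ) : ℝ := u ⬝ᵥ (J *ᵥ v)

/-- `O(3,1)`: the matrices preserving the Minkowski form (they are invertible since `J` is). -/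
def O31 : Set (Matrix (Fin 4) (Fin 4) ℝ) := {Θ | Θᵀ * J * Θ = J}

/-- Points of the cone with `u₃ ≠ 0` in the coordinates `𝐮 = (u₁, u₂, u₃)`:
`u₀` is recovered from `u₁² + u₂² = 2 u₀ u₃`. -/
def lift (p : Fin 3 → ℝ) : Fin 4 → ℝ :=
  ![(p 0 ^ 2 + p 1 ^ 2) / (2 * p 2), p 0, p 1, p 2]

/-- The coordinates `(u₁, u₂, u₃)` of a vector `(u₀, u₁, u₂, u₃)`. -/
def coords (w : Fin 4 → ℝ) : Fin 3 → ℝ := ![w 1, w 2, w 3]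

/-- The map `Φ_g`, i.e. the linear action `u ↦ g u` on the cone, in the coordinates `𝐮`. -/
def Phi (g : Matrix (Fin 4) (Fin 4) ℝ) (p : Fin 3 → ℝ) : Fin 3 → ℝ := coords (g *ᵥ lift p)

/-- The base point `o = e₄ = (0, 0, 0, 1)ᵀ`, in coordinates. -/
def base : Fin 3 → ℝ := ![0, 0, 1]

/-! ### Curves in the cone

A curve is given by its coordinates `γ = (u₁, u₂, u₃)`; the curve in the cone is
`u = lift ∘ γ`. -/

/-- The `j`-th derivative `u^{(j)}` in `ℝ⁴` of the curve `u = lift ∘ γ`. -/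
def der (γ : ℝ → Fin 3 → ℝ) (j : ℕ) (x : ℝ) : Fin 4 → ℝ :=
  iteratedDeriv j (fun y => lift (γ y)) x

/-- `u₃ ≠ 0` and `‖u'‖_J² > 0` at the parameter `x`. -/
def NonRadialAt (γ : ℝ → Fin 3 → ℝ) (x : ℝ) : Prop :=
  γ x 2 ≠ 0 ∧ 0 < mink (der γ 1 x) (der γ 1 x)

/-- `det (𝐮^{(a)}, 𝐮^{(b)}, 𝐮^{(c)})`, with `𝐮 = (u₁, u₂, u₃)`. -/
def det3 (γ : ℝ → Fin 3 → ℝ) (a b c : ℕ) (x : ℝ) : ℝ :=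
  Matrix.det (Matrix.of ![iteratedDeriv a γ x, iteratedDeriv b γ x, iteratedDeriv c γ x])

/-- `k₀ = ‖u'‖_J`. -/
def k0 (γ : ℝ → Fin 3 → ℝ) (x : ℝ) : ℝ := Real.sqrt (mink (der γ 1 x) (der γ 1 x))

/-- `k₁ = (⟨u', u''⟩² - ‖u'‖_J² ‖u''‖_J²) / (2 ‖u'‖_J⁵)`. -/
def k1 (γ : ℝ → Fin 3 → ℝ) (x : ℝ) : ℝ :=
  (mink (der γ 1 x) (der γ 2 x) ^ 2
    - mink (der γ 1 x) (der γ 1 x) * mink (der γ 2 x) (der γ 2 x)) / (2 * k0 γ x ^ 5)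

/-- `k₂ = det(𝐮, 𝐮', 𝐮''') / (u₃ ‖u'‖_J³) - 3 ⟨u', u''⟩ det(𝐮, 𝐮', 𝐮'') / (u₃ ‖u'‖_J⁵)`. -/
def k2 (γ : ℝ → Fin 3 → ℝ) (x : ℝ) : ℝ :=
  det3 γ 0 1 3 x / (γ x 2 * k0 γ x ^ 3)
    - 3 * mink (der γ 1 x) (der γ 2 x) * det3 γ 0 1 2 x / (γ x 2 * k0 γ x ^ 5)

/-! ### The moving frame -/

/-- The rotation `A`. -/
def A (γ : ℝ → Fin 3 → ℝ) (x : ℝ) : Matrix (Fin 2) (Fin 2) ℝ :=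
  let u := γ x
  let u' := deriv γ x
  (1 / (u 2 * k0 γ x)) •
    !![u 2 * u' 0 - u 0 * u' 2, u 2 * u' 1 - u 1 * u' 2;
       u 1 * u' 2 - u 2 * u' 1, u 2 * u' 0 - u 0 * u' 2]

/-- The vector `ξ = (ξ₁, ξ₂)`. -/
def xi (γ : ℝ → Fin 3 → ℝ) (x : ℝ) : Fin 2 → ℝ :=
  ![-(deriv γ x 2) / (γ x 2 * k0 γ x), -(det3 γ 0 1 2 x) / (γ x 2 * k0 γ x ^ 3)]

/-- The factor `g₁` of a Lorentz matrix. -/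
def gOne (ξ : Fin 2 → ℝ) : Matrix (Fin 4) (Fin 4) ℝ :=
  !![1, 0, 0, 0;
     ξ 0, 1, 0, 0;
     ξ 1, 0, 1, 0;
     (ξ 0 ^ 2 + ξ 1 ^ 2) / 2, ξ 0, ξ 1, 1]

/-- The factor `g₀` of a Lorentz matrix. -/
def gZero (α : ℝ) (B : Matrix (Fin 2) (Fin 2) ℝ) : Matrix (Fin 4) (Fin 4) ℝ :=
  !![α, 0, 0, 0;
     0, B 0 0, B 0 1, 0;
     0, B 1 0, B 1 1, 0;
     0, 0, 0, α⁻¹]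

/-- The factor `g₋₁` of a Lorentz matrix. -/
def gMinus (v : Fin 2 → ℝ) : Matrix (Fin 4) (Fin 4) ℝ :=
  !![1, v 0, v 1, (v 0 ^ 2 + v 1 ^ 2) / 2;
     0, 1, 0, v 0;
     0, 0, 1, v 1;
     0, 0, 0, 1]

/-- The right moving frame `ρ_L = g₁ g₀ g₋₁` with `α = u₃`, `v = -û/u₃`. -/
def rho (γ : ℝ → Fin 3 → ℝ) (x : ℝ) : Matrix (Fin 4) (Fin 4) ℝ :=
  gOne (xi γ x) * gZero (γ x 2) (A γ x) * gMinus ![-(γ x 0) / γ x 2, -(γ x 1) / γ x 2]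

/-- The right Maurer-Cartan matrix `K_L`. -/
def KL (γ : ℝ → Fin 3 → ℝ) (x : ℝ) : Matrix (Fin 4) (Fin 4) ℝ :=
  !![0, -k0 γ x, 0, 0;
     -k1 γ x, 0, 0, -k0 γ x;
     -k2 γ x, 0, 0, 0;
     0, -k1 γ x, -k2 γ x, 0]

/-- The explicit `3 × 3` matrix with blocks `A⁻¹ - û ξᵀ`, `û`, `-u₃ ξᵀ`, `u₃`. -/
def frame (γ : ℝ → Fin 3 → ℝ) (x : ℝ) : Matrix (Fin 3) (Fin 3) ℝ :=
  let u := γ x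
  let B := (A γ x)⁻¹
  let ξ := xi γ x
  !![B 0 0 - u 0 * ξ 0, B 0 1 - u 0 * ξ 1, u 0;
     B 1 0 - u 1 * ξ 0, B 1 1 - u 1 * ξ 1, u 1;
     -(u 2 * ξ 0), -(u 2 * ξ 1), u 2]

/-! ### Jets and invariant evolutions -/

/-- The coordinates `(𝐮, 𝐮', …, 𝐮^{(n)})` of an `n`-jet (also used for the jets of
`(k₀, k₁, k₂)`). -/
abbrev Jet (n : ℕ) : Type := Fin (n + 1) → Fin 3 → ℝ

/-- The `n`-jet of a curve at `x`. -/
def jet (n : ℕ) (γ : ℝ → Fin 3 → ℝ) (x : ℝ) : Jet n := fun j => iteratedDeriv j γ x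

/-- The `n`-jet at `x` of the invariants `(k₀, k₁, k₂)` of a curve. -/
def invJet (n : ℕ) (γ : ℝ → Fin 3 → ℝ) (x : ℝ) : Jet n :=
  jet n (fun y => ![k0 γ y, k1 γ y, k2 γ y]) x

/-- Invariance of the evolution `𝐮_t = F(𝐮, 𝐮', …, 𝐮^{(n)})`, with right-hand side defined for
jets in `D`, under the Lorentz group: `g` carries the evolution to itself, that is,
`F(g · j) = dΦ_g (F(j))` for the prolonged action on jets `j` of non-radial curves. -/
def InvariantEvolution (n : ℕ) (D : Set (Jet n)) (F : Jet n → Fin 3 → ℝ) : Prop :=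
  ∀ g ∈ O31, ∀ (γ : ℝ → Fin 3 → ℝ) (x : ℝ),
    ContDiffAt ℝ ∞ γ x → NonRadialAt γ x → Phi g (γ x) 2 ≠ 0 →
    jet n γ x ∈ D → jet n (fun y => Phi g (γ y)) x ∈ D →
      F (jet n (fun y => Phi g (γ y)) x) = fderiv ℝ (Phi g) (γ x) (F (jet n γ x))

/-- The jets of invariants of the non-radial curves whose `n`-jet lies in `D`. -/
def invJets (n : ℕ) (D : Set (Jet n)) : Set (Jet n) :=
  {κ | ∃ (γ : ℝ → Fin 3 → ℝ) (x : ℝ), ContDiffAt ℝ ∞ γ x ∧ NonRadialAt γ x ∧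
    jet n γ x ∈ D ∧ invJet n γ x = κ}

/-- `u : T × X → cone` is a smooth family (time `t ∈ T`, parameter `x ∈ X`) of non-radial curves
evolving by `𝐮_t = (A⁻¹ - û ξᵀ, û; -u₃ ξᵀ, u₃) (r₁, r₂, r₃)ᵀ`. -/
structure IsFlow (T X : Set ℝ) (u r : ℝ → ℝ → Fin 3 → ℝ) : Prop where
  smooth : ContDiffOn ℝ ∞ (fun q : ℝ × ℝ => u q.1 q.2) (T ×ˢ X)
  nonRadial : ∀ t ∈ T, ∀ x ∈ X, NonRadialAt (u t) x
  evolves : ∀ t ∈ T, ∀ x ∈ X, HasDerivAt (fun s => u s x) (frame (u t) x *ᵥ r t x) t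

/-- The arc-length `k₀ = ‖u'‖_J` does not depend on time. -/
def PreservesArcLength (T X : Set ℝ) (u : ℝ → ℝ → Fin 3 → ℝ) : Prop :=
  ∀ s ∈ T, ∀ t ∈ T, ∀ x ∈ X, k0 (u s) x = k0 (u t) x

/-- The matrix differential operator
`P = (-D³ + k₁D + Dk₁, Dk₂ + k₂D; Dk₂ + k₂D, D³ - Dk₁ - k₁D)`, `D = d/dx`,
applied to `(f₁, f₂)`. -/
def opP (κ₁ κ₂ f₁ f₂ : ℝ → ℝ) (x : ℝ) : ℝ × ℝ :=
  (-(iteratedDeriv 3 f₁ x) + κ₁ x * deriv f₁ x + deriv (fun y => κ₁ y * f₁ y) x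
      + (deriv (fun y => κ₂ y * f₂ y) x + κ₂ x * deriv f₂ x),
   deriv (fun y => κ₂ y * f₁ y) x + κ₂ x * deriv f₁ x
      + (iteratedDeriv 3 f₂ x - deriv (fun y => κ₁ y * f₂ y) x - κ₁ x * deriv f₂ x))

end LightCone

end

noncomputable section

namespace LightCone

/-! ### Linear algebra of the Lorentz group -/

/-! The frame `rho` is governed by the normalizations ρu = e₄, ρu' = k₀e₂ and (ρu'')₃ = 0.
Differentiating ⟨u,u⟩ = 0 yields the products ⟨u,u^{(j)}⟩ needed to check them. The matrix ρ_xρ⁻¹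
lies in the Lie algebra of O(3,1), so it has six free entries. Differentiating the three
normalizations determines all six, and the result is `KL` (`eq_of_mink_skew`, `hasDerivAt_rho`).

The group acts linearly on ℝ⁴, hence on every derivative u^{(j)}. The vectors ρu^{(j)} are a normal
form of the jet: by the recursion (ρu^{(j)})' = K ρu^{(j)} + ρu^{(j+1)} they are smooth functions of
the invariants and their derivatives (`exists_normalForm`). Two jets with the same invariants
therefore differ by g = ρ₀⁻¹ρ ∈ O(3,1), and invariance of F says that its components in the moving
frame agree on both (`InvariantEvolution.eq_frame_mulVec`). So the components are functions of the
invariants. They are smooth because, locally, they can be computed with one frozen frame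
(`exists_invariant_components`).

For a flow, ρu_t = (0, r₁, r₂, r₃), and differentiating ρu = e₄ in time gives the last column of N =
ρ_tρ⁻¹. Equality of mixed partials of ρ is the zero-curvature equation K_t + KN = N_x + NK
(`zero_curvature`). Three of its entries solve for the remaining entries of N, and three others are
the evolution equations of k₀, k₁, k₂ (`IsFlow.exists_structure_equations`). Setting k₀ = 1 and r₃ =
-r₁' turns the last two into the operator P. -/

theorem mink_eq (u v : Fin 4 → ℝ) :
    mink u v = u 1 * v 1 + u 2 * v 2 - u 0 * v 3 - u 3 * v 0 := by
  simp [mink, J, Matrix.mulVec, dotProduct, Fin.sum_univ_four]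
  ring

theorem mink_comm (u v : Fin 4 → ℝ) : mink u v = mink v u := by
  rw [mink_eq, mink_eq]; ring

theorem mink_lift_self {p : Fin 3 → ℝ} (hp : p 2 ≠ 0) : mink (lift p) (lift p) = 0 := by
  simp [mink_eq, lift]; field_simp; ring

theorem coords_lift (p : Fin 3 → ℝ) : coords (lift p) = p := by
  ext i; fin_cases i <;> simp [coords, lift]

/-- A vector orthogonal to a point of the cone is determined by its last three coordinates. -/
theorem eq_of_mink_eq_of_coords_eq {u v w : Fin 4 → ℝ} (hu : u 3 ≠ 0)
    (h : mink u v = mink u w) (hc : coords v = coords w) : v = w := by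
  have h1 : v 1 = w 1 := congrFun hc 0
  have h2 : v 2 = w 2 := congrFun hc 1
  have h3 : v 3 = w 3 := congrFun hc 2
  rw [mink_eq, mink_eq, h1, h2, h3] at h
  have h0 : v 0 = w 0 := mul_left_cancel₀ hu (by linarith)
  ext i; fin_cases i <;> assumption

theorem mink_mulVec {g : Matrix (Fin 4) (Fin 4) ℝ} (hg : g ∈ O31) (u v : Fin 4 → ℝ) :
    mink (g *ᵥ u) (g *ᵥ v) = mink u v := by
  have hg' : gᵀ * J * g = J := hg
  rw [mink, mink, ← Matrix.vecMul_transpose, ← Matrix.dotProduct_mulVec, Matrix.mulVec_mulVec,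
    Matrix.mulVec_mulVec, hg']

theorem J_mul_J : J * J = 1 := by
  ext i j; fin_cases i <;> fin_cases j <;> simp [J, Matrix.mul_apply, Fin.sum_univ_four]

/-- Since J² = 1, the inverse is polynomial in the entries of g. This gives both the explicit form
of dΦ and the smoothness of ρ_tρ⁻¹ without differentiating matrix inversion. -/
theorem O31_left_inv {g : Matrix (Fin 4) (Fin 4) ℝ} (hg : g ∈ O31) : J * gᵀ * J * g = 1 := by
  have hg' : gᵀ * J * g = J := hg
  rw [Matrix.mul_assoc, Matrix.mul_assoc, ← Matrix.mul_assoc gᵀ, hg', J_mul_J]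

theorem inv_eq_of_mem_O31 {g : Matrix (Fin 4) (Fin 4) ℝ} (hg : g ∈ O31) : g⁻¹ = J * gᵀ * J :=
  Matrix.inv_eq_left_inv (O31_left_inv hg)

theorem inv_mul_of_mem_O31 {g : Matrix (Fin 4) (Fin 4) ℝ} (hg : g ∈ O31) : g⁻¹ * g = 1 := by
  rw [inv_eq_of_mem_O31 hg, O31_left_inv hg]

theorem mul_inv_of_mem_O31 {g : Matrix (Fin 4) (Fin 4) ℝ} (hg : g ∈ O31) : g * g⁻¹ = 1 :=
  mul_eq_one_comm.1 (inv_mul_of_mem_O31 hg)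

theorem mul_mem_O31 {g h : Matrix (Fin 4) (Fin 4) ℝ} (hg : g ∈ O31) (hh : h ∈ O31) :
    g * h ∈ O31 := by
  have hg' : gᵀ * J * g = J := hg
  have hh' : hᵀ * J * h = J := hh
  change (g * h)ᵀ * J * (g * h) = J
  calc (g * h)ᵀ * J * (g * h) = hᵀ * (gᵀ * J * g) * h := by
        simp only [Matrix.transpose_mul, Matrix.mul_assoc]
    _ = J := by rw [hg', hh']

theorem inv_mem_O31 {g : Matrix (Fin 4) (Fin 4) ℝ} (hg : g ∈ O31) : g⁻¹ ∈ O31 := by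
  have hg' : gᵀ * J * g = J := hg
  change g⁻¹ᵀ * J * g⁻¹ = J
  calc g⁻¹ᵀ * J * g⁻¹ = (g * g⁻¹)ᵀ * J * (g * g⁻¹) := by
        nth_rewrite 1 [← hg']
        simp only [Matrix.transpose_mul, Matrix.mul_assoc]
    _ = J := by rw [mul_inv_of_mem_O31 hg]; simp

theorem gOne_mem_O31 (ξ : Fin 2 → ℝ) : gOne ξ ∈ O31 := by
  change (gOne ξ)ᵀ * J * gOne ξ = J
  ext i j
  fin_cases i <;> fin_cases j <;>
    (simp [gOne, J, Matrix.mul_apply, Fin.sum_univ_four]; try ring)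

theorem gMinus_mem_O31 (v : Fin 2 → ℝ) : gMinus v ∈ O31 := by
  change (gMinus v)ᵀ * J * gMinus v = J
  ext i j
  fin_cases i <;> fin_cases j <;>
    (simp [gMinus, J, Matrix.mul_apply, Fin.sum_univ_four]; try ring)

theorem gZero_mem_O31 {α : ℝ} (hα : α ≠ 0) {B : Matrix (Fin 2) (Fin 2) ℝ} (hB : Bᵀ * B = 1) :
    gZero α B ∈ O31 := by
  have h00 := congrFun (congrFun hB 0) 0
  have h01 := congrFun (congrFun hB 0) 1
  have h10 := congrFun (congrFun hB 1) 0
  have h11 := congrFun (congrFun hB 1) 1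
  simp [Matrix.mul_apply, Fin.sum_univ_two] at h00 h01 h10 h11
  change (gZero α B)ᵀ * J * gZero α B = J
  ext i j
  fin_cases i <;> fin_cases j <;>
    simp [gZero, J, Matrix.mul_apply, Fin.sum_univ_four, *]

/-- The embedding of the tangent space of the cone at `e₄`. -/
def tang (r : Fin 3 → ℝ) : Fin 4 → ℝ := ![0, r 0, r 1, r 2]

theorem coords_tang (r : Fin 3 → ℝ) : coords (tang r) = r := by
  ext i; fin_cases i <;> simp [coords, tang]

theorem tang_coords {w : Fin 4 → ℝ} (h : w 0 = 0) : tang (coords w) = w := by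
  ext i; fin_cases i <;> simp [coords, tang, h]

/-- The differential of `lift`. -/
def dlift (p v : Fin 3 → ℝ) : Fin 4 → ℝ :=
  ![(p 0 * v 0 + p 1 * v 1) / p 2 - (p 0 ^ 2 + p 1 ^ 2) * v 2 / (2 * p 2 ^ 2), v 0, v 1, v 2]

theorem coords_dlift (p v : Fin 3 → ℝ) : coords (dlift p v) = v := by
  ext i; fin_cases i <;> simp [coords, dlift]

theorem mink_lift_dlift {p : Fin 3 → ℝ} (hp : p 2 ≠ 0) (v : Fin 3 → ℝ) :
    mink (lift p) (dlift p v) = 0 := by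
  simp [mink_eq, lift, dlift]; field_simp; ring

/-! ### The moving frame at a point -/

section Frame

variable {γ : ℝ → Fin 3 → ℝ} {x : ℝ}

theorem k0_pos (h : NonRadialAt γ x) : 0 < k0 γ x := Real.sqrt_pos.2 h.2

theorem k0_sq (h : NonRadialAt γ x) : k0 γ x ^ 2 = mink (der γ 1 x) (der γ 1 x) :=
  Real.sq_sqrt h.2.le

/-- Conceptually, the first entry of ρw is -⟨ρw, e₄⟩, and e₄ = ρu. The entry thus vanishes exactly
on the vectors orthogonal to u. -/
theorem rho_mulVec_zero (h : γ x 2 ≠ 0) (w : Fin 4 → ℝ) :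
    (rho γ x *ᵥ w) 0 = -mink (lift (γ x)) w := by
  simp [rho, gOne, gZero, gMinus, mink_eq, lift, Matrix.mulVec, dotProduct, Matrix.mul_apply,
    Fin.sum_univ_four]
  field_simp
  ring

theorem rho_mulVec_one (h : γ x 2 ≠ 0) (hk : k0 γ x ≠ 0) (w : Fin 4 → ℝ) :
    (rho γ x *ᵥ w) 1 = -xi γ x 0 * mink (lift (γ x)) w
      + ((γ x 2 * deriv γ x 0 - γ x 0 * deriv γ x 2) * (γ x 2 * w 1 - γ x 0 * w 3)
        + (γ x 2 * deriv γ x 1 - γ x 1 * deriv γ x 2) * (γ x 2 * w 2 - γ x 1 * w 3))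
          / (γ x 2 ^ 2 * k0 γ x) := by
  simp [rho, gOne, gZero, gMinus, mink_eq, lift, Matrix.mulVec, dotProduct, Matrix.mul_apply,
    Fin.sum_univ_four, A]
  field_simp
  ring

/-- On vectors orthogonal to u this row is a multiple of det(𝐮, 𝐮', ·), which is where the
determinants in ξ₂ and k₂ come from. The ξ₂ term is the correction that makes the entry vanish on
u''. -/
theorem rho_mulVec_two (h : γ x 2 ≠ 0) (hk : k0 γ x ≠ 0) (w : Fin 4 → ℝ) :
    (rho γ x *ᵥ w) 2 = -xi γ x 1 * mink (lift (γ x)) w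
      + Matrix.det (Matrix.of ![γ x, deriv γ x, coords w]) / (γ x 2 * k0 γ x) := by
  simp [rho, gOne, gZero, gMinus, mink_eq, lift, Matrix.mulVec, dotProduct, Matrix.mul_apply,
    Fin.sum_univ_four, A, Matrix.det_fin_three, coords]
  field_simp
  ring

end Frame

/-! ### Iterated derivatives -/

section Calculus

variable {E F : Type*} [NormedAddCommGroup E] [NormedSpace ℝ E]
  [NormedAddCommGroup F] [NormedSpace ℝ F]

theorem contDiffAt_deriv {n m : ℕ∞ω} {f : ℝ → E} {x : ℝ} (hf : ContDiffAt ℝ n f x)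
    (h : m + 1 ≤ n) : ContDiffAt ℝ m (deriv f) x := by
  have h1 := (hf.fderiv_right h).clm_apply (contDiffAt_const (c := (1 : ℝ)))
  simpa using h1

theorem contDiffAt_iteratedDeriv {m : ℕ} (j : ℕ) {f : ℝ → E} {x : ℝ}
    (hf : ContDiffAt ℝ ((m + j : ℕ) : ℕ∞ω) f x) : ContDiffAt ℝ m (iteratedDeriv j f) x := by
  induction j generalizing f with
  | zero => simpa using hf
  | succ j ih =>
    rw [iteratedDeriv_succ']
    exact ih (contDiffAt_deriv hf (by norm_cast))

theorem hasDerivAt_iteratedDeriv {j : ℕ} {f : ℝ → E} {x : ℝ}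
    (hf : ContDiffAt ℝ ((j + 1 : ℕ) : ℕ∞ω) f x) :
    HasDerivAt (iteratedDeriv j f) (iteratedDeriv (j + 1) f x) x := by
  rw [iteratedDeriv_succ]
  refine DifferentiableAt.hasDerivAt ?_
  rw [add_comm] at hf
  exact (contDiffAt_iteratedDeriv j hf).differentiableAt (by simp)

theorem iteratedDeriv_clm_apply (L : E →L[ℝ] F) {j : ℕ} {f : ℝ → E} {x : ℝ}
    (hf : ContDiffAt ℝ j f x) :
    iteratedDeriv j (fun y => L (f y)) x = L (iteratedDeriv j f x) := by
  have := L.iteratedFDeriv_comp_left hf (i := j) le_rfl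
  simp only [iteratedDeriv_eq_iteratedFDeriv]
  change iteratedFDeriv ℝ j (⇑L ∘ f) x _ = _
  rw [this]; rfl

end Calculus

/-! ### Derivatives of a curve in the cone -/

/-- `coords` as a continuous linear map. -/
def coordsL : (Fin 4 → ℝ) →L[ℝ] (Fin 3 → ℝ) :=
  LinearMap.toContinuousLinearMap
    { toFun := coords
      map_add' := fun u v => by ext i; fin_cases i <;> simp [coords]
      map_smul' := fun c v => by ext i; fin_cases i <;> simp [coords] }

theorem coordsL_apply (w : Fin 4 → ℝ) : coordsL w = coords w := rfl

/-- Multiplication by a matrix as a continuous linear map. -/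
def mulVecL (g : Matrix (Fin 4) (Fin 4) ℝ) : (Fin 4 → ℝ) →L[ℝ] (Fin 4 → ℝ) :=
  LinearMap.toContinuousLinearMap (Matrix.mulVecLin g)

theorem mulVecL_apply (g : Matrix (Fin 4) (Fin 4) ℝ) (w : Fin 4 → ℝ) :
    mulVecL g w = g *ᵥ w := rfl

theorem contDiffAt_lift {m : ℕ∞ω} {p : Fin 3 → ℝ} (hp : p 2 ≠ 0) : ContDiffAt ℝ m lift p := by
  have h (i : Fin 3) : ContDiffAt ℝ m (fun q : Fin 3 → ℝ => q i) p := contDiffAt_apply ..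
  rw [contDiffAt_pi]
  intro i
  fin_cases i
  · exact (((h 0).pow 2).add ((h 1).pow 2)).div (contDiffAt_const.mul (h 2)) (by simpa using hp)
  · exact h 0
  · exact h 1
  · exact h 2

theorem hasDerivAt_lift {c : ℝ → Fin 3 → ℝ} {c' : Fin 3 → ℝ} {t : ℝ} (hc : HasDerivAt c c' t)
    (h : c t 2 ≠ 0) : HasDerivAt (fun s => lift (c s)) (dlift (c t) c') t := by
  rw [hasDerivAt_pi] at hc ⊢
  intro i
  fin_cases i
  · refine ((((hc 0).pow 2).add ((hc 1).pow 2)).div ((hc 2).const_mul 2)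
      (by simpa using h)).congr_deriv ?_
    simp [dlift]
    field_simp
  · exact hc 0
  · exact hc 1
  · exact hc 2

theorem hasFDerivAt_lift {p : Fin 3 → ℝ} (hp : p 2 ≠ 0) :
    HasFDerivAt lift (fderiv ℝ lift p) p :=
  ((contDiffAt_lift (m := 1) hp).differentiableAt (by simp)).hasFDerivAt

/-- The differential is evaluated along the line p + sv, so the one-variable formula
`hasDerivAt_lift` suffices. -/
theorem fderiv_lift_apply {p : Fin 3 → ℝ} (hp : p 2 ≠ 0) (v : Fin 3 → ℝ) :
    fderiv ℝ lift p v = dlift p v := by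
  have hline : HasDerivAt (fun s : ℝ => p + s • v) v 0 := by
    simpa using ((hasDerivAt_id (0 : ℝ)).smul_const v).const_add p
  have h1 := hasDerivAt_lift hline (by simpa using hp)
  have h2 := (show HasFDerivAt lift (fderiv ℝ lift p) (p + (0 : ℝ) • v) by
    simpa using hasFDerivAt_lift hp).comp_hasDerivAt (0 : ℝ) hline
  simpa using h2.unique h1

theorem hasFDerivAt_Phi (g : Matrix (Fin 4) (Fin 4) ℝ) {p : Fin 3 → ℝ} (hp : p 2 ≠ 0) :
    HasFDerivAt (Phi g) ((coordsL.comp (mulVecL g)).comp (fderiv ℝ lift p)) p :=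
  (coordsL.comp (mulVecL g)).hasFDerivAt.comp p (hasFDerivAt_lift hp)

theorem fderiv_Phi_apply (g : Matrix (Fin 4) (Fin 4) ℝ) {p : Fin 3 → ℝ} (hp : p 2 ≠ 0)
    (v : Fin 3 → ℝ) : fderiv ℝ (Phi g) p v = coords (g *ᵥ dlift p v) := by
  rw [(hasFDerivAt_Phi g hp).fderiv]
  simp [fderiv_lift_apply hp, coordsL_apply, mulVecL_apply]

section Curve

variable {γ : ℝ → Fin 3 → ℝ} {x : ℝ}

theorem der_zero : der γ 0 x = lift (γ x) := by simp [der]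

theorem contDiffAt_lift_comp {m : ℕ∞ω} (hγ : ContDiffAt ℝ m γ x) (h : γ x 2 ≠ 0) :
    ContDiffAt ℝ m (fun y => lift (γ y)) x :=
  (contDiffAt_lift (m := m) h).comp x hγ

theorem hasDerivAt_der {j : ℕ} (hγ : ContDiffAt ℝ ((j + 1 : ℕ) : ℕ∞ω) γ x) (h : γ x 2 ≠ 0) :
    HasDerivAt (der γ j) (der γ (j + 1) x) x :=
  hasDerivAt_iteratedDeriv (contDiffAt_lift_comp hγ h)

theorem coords_der {j : ℕ} (hγ : ContDiffAt ℝ j γ x) (h : γ x 2 ≠ 0) :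
    coords (der γ j x) = iteratedDeriv j γ x := by
  have := iteratedDeriv_clm_apply coordsL (contDiffAt_lift_comp hγ h)
  simpa only [coordsL_apply, coords_lift, der] using this.symm

theorem coords_der_one (hγ : ContDiffAt ℝ 1 γ x) (h : γ x 2 ≠ 0) :
    coords (der γ 1 x) = deriv γ x := by
  rw [coords_der (by exact_mod_cast hγ) h, iteratedDeriv_one]

/-- `Phi g` is nonlinear in the coordinates, but it is `lift` followed by a linear map. The
prolonged action on jets is thus just multiplication by g on the ambient derivatives. -/
theorem iteratedDeriv_Phi {j : ℕ} (g : Matrix (Fin 4) (Fin 4) ℝ) (hγ : ContDiffAt ℝ j γ x)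
    (h : γ x 2 ≠ 0) :
    iteratedDeriv j (fun y => Phi g (γ y)) x = coords (g *ᵥ der γ j x) :=
  iteratedDeriv_clm_apply (coordsL.comp (mulVecL g)) (contDiffAt_lift_comp hγ h)

theorem hasDerivAt_mink {a b : ℝ → Fin 4 → ℝ} {a' b' : Fin 4 → ℝ} (ha : HasDerivAt a a' x)
    (hb : HasDerivAt b b' x) :
    HasDerivAt (fun y => mink (a y) (b y)) (mink a' (b x) + mink (a x) b') x := by
  rw [hasDerivAt_pi] at ha hb
  simp only [mink_eq]
  refine (((((ha 1).mul (hb 1)).add ((ha 2).mul (hb 2))).sub ((ha 0).mul (hb 3))).sub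
    ((ha 3).mul (hb 0))).congr_deriv ?_
  ring

theorem eventually_ne_zero (hγ : ContinuousAt γ x) (h : γ x 2 ≠ 0) :
    ∀ᶠ y in nhds x, γ y 2 ≠ 0 :=
  (continuousAt_pi.1 hγ 2).eventually_ne h

/-- This and the next two identities are successive derivatives of ⟨u,u⟩ = 0. Each must hold on a
neighbourhood before it can be differentiated again. -/
theorem mink_der_zero_one (hγ : ContDiffAt ℝ 1 γ x) (h : γ x 2 ≠ 0) :
    mink (der γ 0 x) (der γ 1 x) = 0 := by
  have h1 := hasDerivAt_der (j := 0) (by exact_mod_cast hγ) h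
  have h2 := hasDerivAt_mink h1 h1
  have h3 : (fun y => mink (der γ 0 y) (der γ 0 y)) =ᶠ[nhds x] fun _ => 0 := by
    filter_upwards [eventually_ne_zero hγ.continuousAt h] with y hy
    rw [der_zero, mink_lift_self hy]
  have h4 := h2.unique ((hasDerivAt_const x (0 : ℝ)).congr_of_eventuallyEq h3)
  rw [mink_comm (der γ (0 + 1) x)] at h4
  simpa using h4

theorem eventually_contDiffAt {m : ℕ} (hγ : ContDiffAt ℝ m γ x) (h : γ x 2 ≠ 0) :
    ∀ᶠ y in nhds x, ContDiffAt ℝ m γ y ∧ γ y 2 ≠ 0 :=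
  (hγ.eventually (by simp)).and (eventually_ne_zero hγ.continuousAt h)

theorem mink_der_zero_two (hγ : ContDiffAt ℝ 2 γ x) (h : γ x 2 ≠ 0) :
    mink (der γ 0 x) (der γ 2 x) = -mink (der γ 1 x) (der γ 1 x) := by
  have h0 := hasDerivAt_der (j := 0) (hγ.of_le (by norm_num)) h
  have h1 := hasDerivAt_der (j := 1) (by exact_mod_cast hγ) h
  have h3 : (fun y => mink (der γ 0 y) (der γ 1 y)) =ᶠ[nhds x] fun _ => 0 := by
    filter_upwards [eventually_contDiffAt (m := 2) hγ h] with y hy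
    exact mink_der_zero_one (hy.1.of_le (by norm_num)) hy.2
  have h4 := (hasDerivAt_mink h0 h1).unique
    ((hasDerivAt_const x (0 : ℝ)).congr_of_eventuallyEq h3)
  simp only [zero_add, Nat.reduceAdd] at h4
  linarith

theorem mink_der_zero_three (hγ : ContDiffAt ℝ 3 γ x) (h : γ x 2 ≠ 0) :
    mink (der γ 0 x) (der γ 3 x) = -3 * mink (der γ 1 x) (der γ 2 x) := by
  have h0 := hasDerivAt_der (j := 0) (hγ.of_le (by norm_num)) h
  have h1 := hasDerivAt_der (j := 1) (hγ.of_le (by norm_num)) h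
  have h2 := hasDerivAt_der (j := 2) (by exact_mod_cast hγ) h
  have h3 : (fun y => mink (der γ 0 y) (der γ 2 y) + mink (der γ 1 y) (der γ 1 y))
      =ᶠ[nhds x] fun _ => 0 := by
    filter_upwards [eventually_contDiffAt (m := 3) hγ h] with y hy
    rw [mink_der_zero_two (hy.1.of_le (by norm_num)) hy.2]; ring
  have h4 := ((hasDerivAt_mink h0 h2).add (hasDerivAt_mink h1 h1)).unique
    ((hasDerivAt_const x (0 : ℝ)).congr_of_eventuallyEq h3)
  simp only [zero_add, Nat.reduceAdd] at h4
  rw [mink_comm (der γ 2 x)] at h4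
  linarith

end Curve

/-! ### Smoothness of the invariants and of the frame in parameters -/

section Smooth

variable {E : Type*} [NormedAddCommGroup E] [NormedSpace ℝ E] {m : ℕ∞ω}
  {c : E → ℝ → Fin 3 → ℝ} {p : E → ℝ} {e : E}

theorem contDiffAt_mink {a b : E → Fin 4 → ℝ} (ha : ContDiffAt ℝ m a e)
    (hb : ContDiffAt ℝ m b e) : ContDiffAt ℝ m (fun q => mink (a q) (b q)) e := by
  rw [contDiffAt_pi] at ha hb
  simp only [mink_eq]
  exact ((((ha 1).mul (hb 1)).add ((ha 2).mul (hb 2))).sub ((ha 0).mul (hb 3))).sub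
    ((ha 3).mul (hb 0))

/-- Both the curve `c q` and the evaluation point `p q` depend on the parameter q. A constant `c`
with `p = id` covers a single curve, and `p = Prod.snd` covers a flow. -/
theorem contDiffAt_k0 (h1 : ContDiffAt ℝ m (fun q => der (c q) 1 (p q)) e)
    (h : NonRadialAt (c e) (p e)) : ContDiffAt ℝ m (fun q => k0 (c q) (p q)) e :=
  (contDiffAt_mink h1 h1).sqrt h.2.ne'

theorem contDiffAt_k1 (h1 : ContDiffAt ℝ m (fun q => der (c q) 1 (p q)) e)
    (h2 : ContDiffAt ℝ m (fun q => der (c q) 2 (p q)) e)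
    (h : NonRadialAt (c e) (p e)) : ContDiffAt ℝ m (fun q => k1 (c q) (p q)) e :=
  (((contDiffAt_mink h1 h2).pow 2).sub ((contDiffAt_mink h1 h1).mul (contDiffAt_mink h2 h2))).div
    (contDiffAt_const.mul ((contDiffAt_k0 h1 h).pow 5)) (by have := k0_pos h; positivity)

theorem contDiffAt_det3 {i j k : ℕ} (hi : ContDiffAt ℝ m (fun q => iteratedDeriv i (c q) (p q)) e)
    (hj : ContDiffAt ℝ m (fun q => iteratedDeriv j (c q) (p q)) e)
    (hk : ContDiffAt ℝ m (fun q => iteratedDeriv k (c q) (p q)) e) :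
    ContDiffAt ℝ m (fun q => det3 (c q) i j k (p q)) e := by
  rw [contDiffAt_pi] at hi hj hk
  have hij (a b d : Fin 3) := ((hi a).mul (hj b)).mul (hk d)
  simp only [det3, Matrix.det_fin_three]
  exact (((((hij 0 1 2).sub (hij 0 2 1)).sub (((hi 1).mul (hj 0)).mul (hk 2))).add
    (((hi 1).mul (hj 2)).mul (hk 0))).add (((hi 2).mul (hj 0)).mul (hk 1))).sub
    (((hi 2).mul (hj 1)).mul (hk 0))

theorem contDiffAt_k2 (hd : ∀ j ≤ 2, ContDiffAt ℝ m (fun q => der (c q) j (p q)) e)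
    (hc : ∀ j ≤ 3, ContDiffAt ℝ m (fun q => iteratedDeriv j (c q) (p q)) e)
    (h : NonRadialAt (c e) (p e)) : ContDiffAt ℝ m (fun q => k2 (c q) (p q)) e := by
  have h1 := hd 1 (by norm_num)
  have h2 := hd 2 (by norm_num)
  have hk := contDiffAt_k0 h1 h
  have h0 : ContDiffAt ℝ m (fun q => c q (p q) 2) e :=
    contDiffAt_pi.1 (by simpa using hc 0 (by norm_num)) 2
  have hd3 (k : ℕ) (hk : k ≤ 3) :=
    contDiffAt_det3 (hc 0 (by norm_num)) (hc 1 (by norm_num)) (hc k hk)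
  have hpos := (k0_pos h).ne'
  exact ((hd3 3 le_rfl).div (h0.mul (hk.pow 3)) (mul_ne_zero h.1 (pow_ne_zero _ hpos))).sub
    (((contDiffAt_const.mul (contDiffAt_mink h1 h2)).mul (hd3 2 (by norm_num))).div
      (h0.mul (hk.pow 5)) (mul_ne_zero h.1 (pow_ne_zero _ hpos)))

theorem contDiffAt_xi (h1 : ContDiffAt ℝ m (fun q => der (c q) 1 (p q)) e)
    (hc : ∀ j ≤ 2, ContDiffAt ℝ m (fun q => iteratedDeriv j (c q) (p q)) e)
    (h : NonRadialAt (c e) (p e)) (i : Fin 2) :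
    ContDiffAt ℝ m (fun q => xi (c q) (p q) i) e := by
  have hk := contDiffAt_k0 h1 h
  have hpos := (k0_pos h).ne'
  have h0 : ContDiffAt ℝ m (fun q => c q (p q) 2) e :=
    contDiffAt_pi.1 (by simpa using hc 0 (by norm_num)) 2
  have h1' : ContDiffAt ℝ m (fun q => deriv (c q) (p q) 2) e :=
    contDiffAt_pi.1 (by simpa using hc 1 (by norm_num)) 2
  fin_cases i
  · exact h1'.neg.div (h0.mul hk) (mul_ne_zero h.1 hpos)
  · exact (contDiffAt_det3 (hc 0 (by norm_num)) (hc 1 (by norm_num)) (hc 2 le_rfl)).neg.div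
      (h0.mul (hk.pow 3)) (mul_ne_zero h.1 (pow_ne_zero _ hpos))

theorem contDiffAt_A (h1 : ContDiffAt ℝ m (fun q => der (c q) 1 (p q)) e)
    (hc : ∀ j ≤ 2, ContDiffAt ℝ m (fun q => iteratedDeriv j (c q) (p q)) e)
    (h : NonRadialAt (c e) (p e)) (i j : Fin 2) :
    ContDiffAt ℝ m (fun q => A (c q) (p q) i j) e := by
  have hk := contDiffAt_k0 h1 h
  have hpos := (k0_pos h).ne'
  have h0 (i : Fin 3) : ContDiffAt ℝ m (fun q => c q (p q) i) e :=
    contDiffAt_pi.1 (by simpa using hc 0 (by norm_num)) i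
  have h1' (i : Fin 3) : ContDiffAt ℝ m (fun q => deriv (c q) (p q) i) e :=
    contDiffAt_pi.1 (by simpa using hc 1 (by norm_num)) i
  have hs : ContDiffAt ℝ m (fun q => 1 / (c q (p q) 2 * k0 (c q) (p q))) e :=
    contDiffAt_const.div ((h0 2).mul hk) (mul_ne_zero h.1 hpos)
  have hw (i j : Fin 3) := ((h0 i).mul (h1' j)).sub ((h0 j).mul (h1' i))
  fin_cases i <;> fin_cases j
  · exact hs.mul (hw 2 0)
  · exact hs.mul (hw 2 1)
  · exact hs.mul (hw 1 2)
  · exact hs.mul (hw 2 0)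

theorem contDiffAt_rho (h1 : ContDiffAt ℝ m (fun q => der (c q) 1 (p q)) e)
    (hc : ∀ j ≤ 2, ContDiffAt ℝ m (fun q => iteratedDeriv j (c q) (p q)) e)
    (h : NonRadialAt (c e) (p e)) (i j : Fin 4) :
    ContDiffAt ℝ m (fun q => rho (c q) (p q) i j) e := by
  have h0 (i : Fin 3) : ContDiffAt ℝ m (fun q => c q (p q) i) e :=
    contDiffAt_pi.1 (by simpa using hc 0 (by norm_num)) i
  have hξ := contDiffAt_xi h1 hc h
  have hA := contDiffAt_A h1 hc h
  have hv (i : Fin 3) : ContDiffAt ℝ m (fun q => -(c q (p q) i) / c q (p q) 2) e :=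
    (h0 i).neg.div (h0 2) h.1
  have hξ2 := (((hξ 0).pow 2).add ((hξ 1).pow 2)).div_const 2
  have hv2 := (((hv 0).pow 2).add ((hv 1).pow 2)).div_const 2
  have hone : ∀ i k, ContDiffAt ℝ m (fun q => gOne (xi (c q) (p q)) i k) e := by
    intro i k
    fin_cases i <;> fin_cases k <;>
      first | exact contDiffAt_const | exact hξ 0 | exact hξ 1 | exact hξ2
  have hzero : ∀ i k, ContDiffAt ℝ m (fun q => gZero (c q (p q) 2) (A (c q) (p q)) i k) e := by
    intro i k
    fin_cases i <;> fin_cases k <;>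
      first | exact contDiffAt_const | exact h0 2 | exact (h0 2).inv h.1 | exact hA _ _
  have hminus : ∀ i k, ContDiffAt ℝ m (fun q => gMinus ![-(c q (p q) 0) / c q (p q) 2,
      -(c q (p q) 1) / c q (p q) 2] i k) e := by
    intro i k
    fin_cases i <;> fin_cases k <;>
      first | exact contDiffAt_const | exact hv 0 | exact hv 1 | exact hv2
  simp only [rho, Matrix.mul_apply]
  exact ContDiffAt.sum fun k _ => (ContDiffAt.sum fun l _ => (hone i l).mul (hzero l k)).mul
    (hminus k j)

end Smooth

section SmoothCurve

variable {γ : ℝ → Fin 3 → ℝ} {x : ℝ}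

theorem contDiffAt_der {m : ℕ} (j : ℕ) (hγ : ContDiffAt ℝ ((m + j : ℕ) : ℕ∞ω) γ x)
    (h : γ x 2 ≠ 0) : ContDiffAt ℝ m (der γ j) x :=
  contDiffAt_iteratedDeriv j (contDiffAt_lift_comp hγ h)

theorem contDiffAt_rho_curve {m : ℕ} (hγ : ContDiffAt ℝ ((m + 2 : ℕ) : ℕ∞ω) γ x)
    (h : NonRadialAt γ x) (i j : Fin 4) : ContDiffAt ℝ m (fun y => rho γ y i j) x :=
  contDiffAt_rho (c := fun _ => γ) (p := id)
    (contDiffAt_der 1 (hγ.of_le (by norm_cast; omega)) h.1)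
    (fun j hj => contDiffAt_iteratedDeriv j (hγ.of_le (by norm_cast; omega))) h i j

theorem contDiffAt_invariants {m : ℕ} (hγ : ContDiffAt ℝ ((m + 3 : ℕ) : ℕ∞ω) γ x)
    (h : NonRadialAt γ x) : ContDiffAt ℝ m (fun y => ![k0 γ y, k1 γ y, k2 γ y]) x := by
  have hd (j : ℕ) (hj : j ≤ 2) : ContDiffAt ℝ m (der γ j) x :=
    contDiffAt_der j (hγ.of_le (by norm_cast; omega)) h.1
  have hc (j : ℕ) (hj : j ≤ 3) : ContDiffAt ℝ m (iteratedDeriv j γ) x :=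
    contDiffAt_iteratedDeriv j (hγ.of_le (by norm_cast; omega))
  have h1 := hd 1 (by norm_num)
  rw [contDiffAt_pi]
  intro i
  fin_cases i
  · exact contDiffAt_k0 (c := fun _ => γ) (p := id) h1 h
  · exact contDiffAt_k1 (c := fun _ => γ) (p := id) h1 (hd 2 le_rfl) h
  · exact contDiffAt_k2 (c := fun _ => γ) (p := id) hd hc h

theorem eventually_nonRadialAt (hγ : ContDiffAt ℝ 1 γ x) (h : NonRadialAt γ x) :
    ∀ᶠ y in nhds x, NonRadialAt γ y := by
  have h1 : ContDiffAt ℝ 0 (der γ 1) x :=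
    contDiffAt_der (m := 0) 1 (by exact_mod_cast hγ) h.1
  exact (eventually_ne_zero hγ.continuousAt h.1).and
    ((contDiffAt_mink h1 h1).continuousAt.eventually (lt_mem_nhds h.2))

end SmoothCurve

/-! ### The normalization equations -/

theorem rho_mulVec_three {γ : ℝ → Fin 3 → ℝ} {x : ℝ} (h : γ x 2 ≠ 0) (w : Fin 4 → ℝ) :
    (rho γ x *ᵥ w) 3 = xi γ x 0 * (rho γ x *ᵥ w) 1 + xi γ x 1 * (rho γ x *ᵥ w) 2
      + (xi γ x 0 ^ 2 + xi γ x 1 ^ 2) / 2 * mink (lift (γ x)) w + w 3 / γ x 2 := by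
  simp [rho, gOne, gZero, gMinus, mink_eq, lift, Matrix.mulVec, dotProduct, Matrix.mul_apply,
    Fin.sum_univ_four]
  field_simp
  ring

theorem rho_mulVec_lift {γ : ℝ → Fin 3 → ℝ} {x : ℝ} (h : γ x 2 ≠ 0) :
    rho γ x *ᵥ lift (γ x) = ![0, 0, 0, 1] := by
  have h0 : (rho γ x *ᵥ lift (γ x)) 0 = 0 := by rw [rho_mulVec_zero h, mink_lift_self h, neg_zero]
  have h1 : (rho γ x *ᵥ lift (γ x)) 1 = 0 := by
    simp [rho, gOne, gZero, gMinus, lift, Matrix.mulVec, dotProduct, Matrix.mul_apply,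
      Fin.sum_univ_four]
    field_simp
    ring
  have h2 : (rho γ x *ᵥ lift (γ x)) 2 = 0 := by
    simp [rho, gOne, gZero, gMinus, lift, Matrix.mulVec, dotProduct, Matrix.mul_apply,
      Fin.sum_univ_four]
    field_simp
    ring
  have h3 : (rho γ x *ᵥ lift (γ x)) 3 = 1 := by
    rw [rho_mulVec_three h, h1, h2, mink_lift_self h]
    simp [lift, h]
  ext i
  fin_cases i <;> assumption

section Frame

variable {γ : ℝ → Fin 3 → ℝ} {x : ℝ}

theorem der_one_apply (hγ : ContDiffAt ℝ 1 γ x) (h : γ x 2 ≠ 0) :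
    der γ 1 x 1 = deriv γ x 0 ∧ der γ 1 x 2 = deriv γ x 1 ∧ der γ 1 x 3 = deriv γ x 2 := by
  have := coords_der_one hγ h
  exact ⟨congrFun this 0, congrFun this 1, congrFun this 2⟩

/-- The relation ⟨u,u'⟩ = 0 eliminates u₀' from ⟨u',u'⟩. Since `A` has the shape (a, b; -b, a)
divided by u₃k₀, the resulting sum of two squares is precisely its orthogonality. -/
theorem k0_sq_eq (hγ : ContDiffAt ℝ 1 γ x) (h : NonRadialAt γ x) :
    (γ x 2 * k0 γ x) ^ 2 = (γ x 2 * deriv γ x 0 - γ x 0 * deriv γ x 2) ^ 2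
      + (γ x 2 * deriv γ x 1 - γ x 1 * deriv γ x 2) ^ 2 := by
  obtain ⟨e1, e2, e3⟩ := der_one_apply hγ h.1
  have ho := mink_der_zero_one hγ h.1
  rw [mul_pow, k0_sq h]
  rw [der_zero, mink_eq, e1, e2, e3] at ho
  rw [mink_eq, e1, e2, e3]
  have h2 := h.1
  simp [lift] at ho
  field_simp at ho
  linear_combination (deriv γ x 2) * ho

theorem A_transpose_mul_self (hγ : ContDiffAt ℝ 1 γ x) (h : NonRadialAt γ x) :
    (A γ x)ᵀ * A γ x = 1 := by
  have hk := (k0_pos h).ne'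
  have h2 := h.1
  have hs := k0_sq_eq hγ h
  ext i j
  fin_cases i <;> fin_cases j <;> simp [A, Matrix.mul_apply, Fin.sum_univ_two] <;> field_simp <;>
    first | linear_combination -hs | ring

theorem rho_mem_O31 (hγ : ContDiffAt ℝ 1 γ x) (h : NonRadialAt γ x) : rho γ x ∈ O31 :=
  mul_mem_O31 (mul_mem_O31 (gOne_mem_O31 _) (gZero_mem_O31 h.1 (A_transpose_mul_self hγ h)))
    (gMinus_mem_O31 _)

theorem rho_mulVec_der_one (hγ : ContDiffAt ℝ 1 γ x) (h : NonRadialAt γ x) :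
    rho γ x *ᵥ der γ 1 x = ![0, k0 γ x, 0, 0] := by
  have hk := (k0_pos h).ne'
  have hp := h.1
  obtain ⟨e1, e2, e3⟩ := der_one_apply hγ h.1
  have ho : mink (lift (γ x)) (der γ 1 x) = 0 := by rw [← der_zero, mink_der_zero_one hγ h.1]
  have h0 : (rho γ x *ᵥ der γ 1 x) 0 = 0 := by rw [rho_mulVec_zero hp, ho, neg_zero]
  have h1 : (rho γ x *ᵥ der γ 1 x) 1 = k0 γ x := by
    rw [rho_mulVec_one hp hk, ho, e1, e2, e3, ← sq, ← sq, ← k0_sq_eq hγ h]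
    field_simp
    ring
  have h2 : (rho γ x *ᵥ der γ 1 x) 2 = 0 := by
    rw [rho_mulVec_two hp hk, ho, coords_der_one hγ hp]
    simp [Matrix.det_fin_three]
    exact Or.inl (by ring)
  have h3 : (rho γ x *ᵥ der γ 1 x) 3 = 0 := by
    rw [rho_mulVec_three hp, h1, h2, ho, e3]
    simp [xi]
    field_simp
    ring
  ext i
  fin_cases i <;> assumption

theorem rho_mulVec_two_of_coords (h : γ x 2 ≠ 0) (hk : k0 γ x ≠ 0) {j : ℕ}
    (hγ : ContDiffAt ℝ j γ x) :
    (rho γ x *ᵥ der γ j x) 2 = -xi γ x 1 * mink (der γ 0 x) (der γ j x)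
      + det3 γ 0 1 j x / (γ x 2 * k0 γ x) := by
  rw [rho_mulVec_two h hk, coords_der hγ h, der_zero]
  simp [det3]

theorem rho_mulVec_der_two_zero (hγ : ContDiffAt ℝ 2 γ x) (h : NonRadialAt γ x) :
    (rho γ x *ᵥ der γ 2 x) 0 = k0 γ x ^ 2 := by
  rw [rho_mulVec_zero h.1, ← der_zero, mink_der_zero_two hγ h.1, k0_sq h, neg_neg]

theorem rho_mulVec_der_two_two (hγ : ContDiffAt ℝ 2 γ x) (h : NonRadialAt γ x) :
    (rho γ x *ᵥ der γ 2 x) 2 = 0 := by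
  have hk := (k0_pos h).ne'
  have hp := h.1
  rw [rho_mulVec_two_of_coords h.1 hk (by exact_mod_cast hγ), mink_der_zero_two hγ h.1, ← k0_sq h]
  simp [xi]
  field_simp
  ring

/-- No row of ρ is expanded here: ρ preserves ⟨u',u''⟩ and ⟨u'',u''⟩. With ρu' = (0, k₀, 0, 0) and
ρu'' = (k₀², a, 0, b), these read k₀a and a² - 2k₀²b, and b follows. -/
theorem rho_mulVec_der_two_three (hγ : ContDiffAt ℝ 2 γ x) (h : NonRadialAt γ x) :
    (rho γ x *ᵥ der γ 2 x) 3 = k0 γ x * k1 γ x := by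
  have hk := (k0_pos h).ne'
  have hρ := rho_mem_O31 (hγ.of_le (by norm_num)) h
  have h0 := rho_mulVec_der_two_zero hγ h
  have h2 := rho_mulVec_der_two_two hγ h
  have h12 := mink_mulVec hρ (der γ 1 x) (der γ 2 x)
  have h22 := mink_mulVec hρ (der γ 2 x) (der γ 2 x)
  rw [rho_mulVec_der_one (hγ.of_le (by norm_num)) h, mink_eq] at h12
  rw [mink_eq] at h22
  simp at h12
  rw [k1, ← h12, ← h22, ← k0_sq h, h0, h2]
  field_simp
  ring

theorem rho_mulVec_der_three_two (hγ : ContDiffAt ℝ 3 γ x) (h : NonRadialAt γ x) :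
    (rho γ x *ᵥ der γ 3 x) 2 = k0 γ x ^ 2 * k2 γ x := by
  have hk := (k0_pos h).ne'
  have hp := h.1
  rw [rho_mulVec_two_of_coords h.1 hk (by exact_mod_cast hγ), mink_der_zero_three hγ h.1]
  simp [xi, k2]
  field_simp
  ring

/-! ### The tangent map of the frame -/

theorem rho_inv_mulVec {w z : Fin 4 → ℝ} (hγ : ContDiffAt ℝ 1 γ x) (h : NonRadialAt γ x)
    (hw : rho γ x *ᵥ w = z) : (rho γ x)⁻¹ *ᵥ z = w := by
  rw [← hw, Matrix.mulVec_mulVec, inv_mul_of_mem_O31 (rho_mem_O31 hγ h), Matrix.one_mulVec]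

theorem rho_mulVec_inv_mulVec (hγ : ContDiffAt ℝ 1 γ x) (h : NonRadialAt γ x) (w : Fin 4 → ℝ) :
    rho γ x *ᵥ ((rho γ x)⁻¹ *ᵥ w) = w := by
  rw [Matrix.mulVec_mulVec, mul_inv_of_mem_O31 (rho_mem_O31 hγ h), Matrix.one_mulVec]

theorem coords_rho_inv_tang (hγ : ContDiffAt ℝ 1 γ x) (h : NonRadialAt γ x) (r : Fin 3 → ℝ) :
    coords ((rho γ x)⁻¹ *ᵥ tang r) = frame γ x *ᵥ r := by
  have hA : (A γ x)⁻¹ = (A γ x)ᵀ := Matrix.inv_eq_left_inv (A_transpose_mul_self hγ h)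
  have hp := h.1
  rw [inv_eq_of_mem_O31 (rho_mem_O31 hγ h)]
  ext i
  fin_cases i <;>
  · simp [frame, hA, rho, gOne, gZero, gMinus, tang, coords, J, Matrix.mulVec, dotProduct,
      Matrix.mul_apply, Matrix.vecMul, Fin.sum_univ_four, Fin.sum_univ_three]
    field_simp
    try ring

theorem mink_lift_rho_inv_tang (hγ : ContDiffAt ℝ 1 γ x) (h : NonRadialAt γ x) (r : Fin 3 → ℝ) :
    mink (lift (γ x)) ((rho γ x)⁻¹ *ᵥ tang r) = 0 := by
  rw [← mink_mulVec (rho_mem_O31 hγ h), rho_mulVec_lift h.1, rho_mulVec_inv_mulVec hγ h, mink_eq]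
  simp [tang]

/-- Both sides are orthogonal to u and have the same last three coordinates; since u₃ ≠ 0, this
determines the vector. -/
theorem dlift_frame_mulVec (hγ : ContDiffAt ℝ 1 γ x) (h : NonRadialAt γ x) (r : Fin 3 → ℝ) :
    dlift (γ x) (frame γ x *ᵥ r) = (rho γ x)⁻¹ *ᵥ tang r := by
  refine eq_of_mink_eq_of_coords_eq (u := lift (γ x)) h.1 ?_ ?_
  · rw [mink_lift_dlift h.1, mink_lift_rho_inv_tang hγ h]
  · rw [coords_dlift, coords_rho_inv_tang hγ h]

theorem rho_mulVec_dlift_frame (hγ : ContDiffAt ℝ 1 γ x) (h : NonRadialAt γ x) (r : Fin 3 → ℝ) :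
    rho γ x *ᵥ dlift (γ x) (frame γ x *ᵥ r) = tang r := by
  rw [dlift_frame_mulVec hγ h, rho_mulVec_inv_mulVec hγ h]

theorem lift_base : lift base = ![0, 0, 0, 1] := by
  ext i; fin_cases i <;> simp [lift, base]

theorem dlift_base (v : Fin 3 → ℝ) : dlift base v = tang v := by
  ext i; fin_cases i <;> simp [dlift, base, tang]

theorem Phi_rho_inv_base (hγ : ContDiffAt ℝ 1 γ x) (h : NonRadialAt γ x) :
    Phi (rho γ x)⁻¹ base = γ x := by
  rw [Phi, lift_base, rho_inv_mulVec hγ h (rho_mulVec_lift h.1), coords_lift]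

theorem hasFDerivAt_Phi_rho_inv (hγ : ContDiffAt ℝ 1 γ x) (h : NonRadialAt γ x) :
    HasFDerivAt (Phi (rho γ x)⁻¹)
      (LinearMap.toContinuousLinearMap (Matrix.toLin' (frame γ x))) base := by
  have hb : base 2 ≠ 0 := by simp [base]
  have h1 := (hasFDerivAt_Phi (rho γ x)⁻¹ hb).differentiableAt.hasFDerivAt
  convert h1 using 1
  ext1 v
  rw [fderiv_Phi_apply _ hb, dlift_base, coords_rho_inv_tang hγ h]
  simp

end Frame

/-! ### Logarithmic derivatives of curves of Lorentz matrices -/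

section LogDeriv

variable {g : ℝ → Matrix (Fin 4) (Fin 4) ℝ} {G N : Matrix (Fin 4) (Fin 4) ℝ} {x : ℝ}

theorem hasDerivAt_mulVec (hg : ∀ i j, HasDerivAt (fun y => g y i j) (G i j) x)
    {w : ℝ → Fin 4 → ℝ} {w' : Fin 4 → ℝ} (hw : HasDerivAt w w' x) :
    HasDerivAt (fun y => g y *ᵥ w y) (G *ᵥ w x + g x *ᵥ w') x := by
  rw [hasDerivAt_pi] at hw ⊢
  intro i
  simp only [Matrix.mulVec, dotProduct, Pi.add_apply, ← Finset.sum_add_distrib]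
  exact HasDerivAt.fun_sum fun j _ => (hg i j).mul (hw j)

theorem hasDerivAt_matrix_mul {h : ℝ → Matrix (Fin 4) (Fin 4) ℝ} {H : Matrix (Fin 4) (Fin 4) ℝ}
    (hg : ∀ i j, HasDerivAt (fun y => g y i j) (G i j) x)
    (hh : ∀ i j, HasDerivAt (fun y => h y i j) (H i j) x) (i j : Fin 4) :
    HasDerivAt (fun y => (g y * h y) i j) ((G * h x + g x * H) i j) x := by
  simp only [Matrix.mul_apply, Matrix.add_apply, ← Finset.sum_add_distrib]
  exact HasDerivAt.fun_sum fun k _ => (hg i k).mul (hh k j)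

/-- The logarithmic derivative of a curve of Lorentz matrices is skew for the Minkowski form. -/
theorem mink_skew_of_hasDerivAt (hO : ∀ᶠ y in nhds x, g y ∈ O31)
    (hg : ∀ i j, HasDerivAt (fun y => g y i j) ((N * g x) i j) x) (a b : Fin 4 → ℝ) :
    mink (N *ᵥ a) b + mink a (N *ᵥ b) = 0 := by
  have hx : g x ∈ O31 := hO.self_of_nhds
  -- Invariance is applied to g(x)⁻¹a and g(x)⁻¹b, so that the moved vectors equal a and b at the
  -- point x.
  have key (v : Fin 4 → ℝ) : g x *ᵥ ((g x)⁻¹ *ᵥ v) = v := by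
    rw [Matrix.mulVec_mulVec, mul_inv_of_mem_O31 hx, Matrix.one_mulVec]
  have hd (v : Fin 4 → ℝ) : HasDerivAt (fun y => g y *ᵥ ((g x)⁻¹ *ᵥ v)) (N *ᵥ v) x := by
    have := hasDerivAt_mulVec hg (hasDerivAt_const x ((g x)⁻¹ *ᵥ v))
    rwa [← Matrix.mulVec_mulVec, key, Matrix.mulVec_zero, add_zero] at this
  have h1 := hasDerivAt_mink (hd a) (hd b)
  have h2 : (fun y => mink (g y *ᵥ ((g x)⁻¹ *ᵥ a)) (g y *ᵥ ((g x)⁻¹ *ᵥ b))) =ᶠ[nhds x]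
      fun _ => mink ((g x)⁻¹ *ᵥ a) ((g x)⁻¹ *ᵥ b) := by
    filter_upwards [hO] with y hy
    exact mink_mulVec hy _ _
  have h3 := h1.unique ((hasDerivAt_const x _).congr_of_eventuallyEq h2)
  rwa [key, key] at h3

/-- Pairing basis vectors gives NᵀJ + JN = 0. The six entries kept as parameters are those reached
by differentiating the normalizations: the last column comes from ρu, then `N 2 1` and `N 3 1` from
ρu', and `N 2 0` from ρu''. -/
theorem eq_of_mink_skew (hN : ∀ a b, mink (N *ᵥ a) b + mink a (N *ᵥ b) = 0) :
    N = !![-N 3 3, N 1 3, N 2 3, 0;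
           N 3 1, 0, -N 2 1, N 1 3;
           N 2 0, N 2 1, 0, N 2 3;
           0, N 3 1, N 2 0, N 3 3] := by
  have h (i j : Fin 4) := hN (Pi.single i 1) (Pi.single j 1)
  simp only [mink_eq, Matrix.mulVec_single_one, Matrix.col_apply] at h
  have h00 := h 0 0
  have h01 := h 0 1
  have h02 := h 0 2
  have h03 := h 0 3
  have h11 := h 1 1
  have h12 := h 1 2
  have h13 := h 1 3
  have h22 := h 2 2
  have h23 := h 2 3
  have h33 := h 3 3
  simp at h00 h01 h02 h03 h11 h12 h13 h22 h23 h33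
  ext i j
  fin_cases i <;> fin_cases j <;> simp <;> linarith

theorem exists_logDeriv (hx : g x ∈ O31)
    (hg : ∀ i j, DifferentiableAt ℝ (fun y => g y i j) x) :
    ∃ N : Matrix (Fin 4) (Fin 4) ℝ, ∀ i j, HasDerivAt (fun y => g y i j) ((N * g x) i j) x := by
  refine ⟨Matrix.of (fun i j => deriv (fun y => g y i j) x) * (g x)⁻¹, fun i j => ?_⟩
  rw [Matrix.mul_assoc, inv_mul_of_mem_O31 hx, Matrix.mul_one]
  exact (hg i j).hasDerivAt

end LogDeriv

section MaurerCartan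

variable {γ : ℝ → Fin 3 → ℝ} {x : ℝ}

theorem eventually_curve {m : ℕ} (hm : 1 ≤ m) (hγ : ContDiffAt ℝ m γ x) (h : NonRadialAt γ x) :
    ∀ᶠ y in nhds x, ContDiffAt ℝ m γ y ∧ NonRadialAt γ y :=
  (hγ.eventually (by simp)).and
    (eventually_nonRadialAt (hγ.of_le (by exact_mod_cast hm)) h)

/-- The Maurer–Cartan matrix of the moving frame. -/
theorem hasDerivAt_rho (hγ : ContDiffAt ℝ 3 γ x) (h : NonRadialAt γ x) (i j : Fin 4) :
    HasDerivAt (fun y => rho γ y i j) ((KL γ x * rho γ x) i j) x := by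
  have hγ3 : ContDiffAt ℝ (3 : ℕ) γ x := by exact_mod_cast hγ
  have hk := (k0_pos h).ne'
  have hev : ∀ᶠ y in nhds x, ContDiffAt ℝ 3 γ y ∧ NonRadialAt γ y := by
    exact_mod_cast eventually_curve (by norm_num) hγ3 h
  have h1 : (1 : ℕ∞ω) ≤ 3 := by norm_num
  have h2 : (2 : ℕ∞ω) ≤ 3 := by norm_num
  have hO : ∀ᶠ y in nhds x, rho γ y ∈ O31 := hev.mono fun y hy => rho_mem_O31 (hy.1.of_le h1) hy.2
  obtain ⟨N, hN⟩ := exists_logDeriv (g := rho γ) hO.self_of_nhds fun i j =>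
    (contDiffAt_rho_curve (m := 1) hγ3 h i j).differentiableAt (by simp)
  have hskew := eq_of_mink_skew (mink_skew_of_hasDerivAt hO hN)
  have hder (j : ℕ) (hj : j ≤ 2) :
      HasDerivAt (fun y => rho γ y *ᵥ der γ j y)
        (N *ᵥ (rho γ x *ᵥ der γ j x) + rho γ x *ᵥ der γ (j + 1) x) x := by
    rw [Matrix.mulVec_mulVec]
    exact hasDerivAt_mulVec hN (hasDerivAt_der (hγ.of_le (by norm_cast; omega)) h.1)
  have e0 : rho γ x *ᵥ der γ 0 x = ![0, 0, 0, 1] := by rw [der_zero, rho_mulVec_lift h.1]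
  have e1 := rho_mulVec_der_one (hγ.of_le h1) h
  have e20 := rho_mulVec_der_two_zero (hγ.of_le h2) h
  have e22 := rho_mulVec_der_two_two (hγ.of_le h2) h
  have e23 := rho_mulVec_der_two_three (hγ.of_le h2) h
  have e32 := rho_mulVec_der_three_two hγ h
  -- Constancy of ρu = e₄ gives N e₄ = -k₀e₂, the whole last column of N.
  have d0 := (hder 0 (by norm_num)).unique ((hasDerivAt_const x ![0, 0, 0, 1]).congr_of_eventuallyEq
    (hev.mono fun y hy => by simp only [der_zero, rho_mulVec_lift hy.2.1]))
  -- Entry 1 of ρu' is k₀, which may vary; the other entries vanish identically. Entries 2 and 3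
  -- yield `N 2 1 = 0` and `N 3 1 = -k₁`.
  have d1 (i : Fin 4) (hi : i ≠ 1) := (hasDerivAt_pi.1 (hder 1 (by norm_num)) i).unique
    ((hasDerivAt_const x 0).congr_of_eventuallyEq (hev.mono fun y hy => by
      dsimp only
      rw [rho_mulVec_der_one (hy.1.of_le h1) hy.2]
      fin_cases i <;> simp at hi ⊢))
  -- The third normalization, differentiated once more, involves ρu''' and fixes `N 2 0`.
  have d2 := (hasDerivAt_pi.1 (hder 2 le_rfl) 2).unique
    ((hasDerivAt_const x 0).congr_of_eventuallyEq (hev.mono fun y hy =>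
      rho_mulVec_der_two_two (hy.1.of_le h2) hy.2))
  have n13 := congrFun d0 1
  have n23 := congrFun d0 2
  have n33 := congrFun d0 3
  have n21 := d1 2 (by decide)
  have n31 := d1 3 (by decide)
  rw [zero_add, e0, e1] at n13 n23 n33
  simp only [Pi.add_apply, e1, Nat.reduceAdd] at n21 n31
  rw [e22] at n21
  rw [e23] at n31
  simp only [Pi.add_apply, Nat.reduceAdd, e32] at d2
  have n22 : N 2 2 = 0 := congrFun (congrFun hskew 2) 2
  simp [Matrix.mulVec, dotProduct, Fin.sum_univ_four] at n13 n23 n33 n21 n31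
  have m21 : N 2 1 = 0 := by simpa [hk] using n21
  have m31 : N 3 1 = -k1 γ x := mul_right_cancel₀ hk (by linarith)
  have m20 : N 2 0 = -k2 γ x := by
    have e : N 2 0 * k0 γ x ^ 2 + k0 γ x ^ 2 * k2 γ x = 0 := by
      rw [Matrix.mulVec, dotProduct, Fin.sum_univ_four, e20, e22, m21, n23] at d2
      linarith
    exact mul_right_cancel₀ (pow_ne_zero 2 hk) (by linarith)
  have m13 : N 1 3 = -k0 γ x := by linarith
  have hNK : N = KL γ x := by
    rw [hskew, m21, m31, m20, m13, n23, n33]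
    simp [KL]
  rw [← hNK]
  exact hN i j

end MaurerCartan

/-! ### Normalized jets -/

/-- The matrix `K_L` as a function of `(k₀, k₁, k₂)`. -/
def KLof (k : Fin 3 → ℝ) : Matrix (Fin 4) (Fin 4) ℝ :=
  !![0, -k 0, 0, 0;
     -k 1, 0, 0, -k 0;
     -k 2, 0, 0, 0;
     0, -k 1, -k 2, 0]

theorem KLof_invJet (n : ℕ) (γ : ℝ → Fin 3 → ℝ) (x : ℝ) : KLof (invJet n γ x 0) = KL γ x := by
  simp [invJet, jet, KLof, KL]

theorem contDiff_KLof_mulVec {E : Type*} [NormedAddCommGroup E] [NormedSpace ℝ E] {m : ℕ∞ω}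
    {k : E → Fin 3 → ℝ} {w : E → Fin 4 → ℝ} (hk : ContDiff ℝ m k) (hw : ContDiff ℝ m w) :
    ContDiff ℝ m (fun e => KLof (k e) *ᵥ w e) := by
  rw [contDiff_pi] at hk hw ⊢
  intro i
  have h0 := hk 0
  have h1 := hk 1
  have h2 := hk 2
  simp only [Matrix.mulVec, dotProduct]
  refine ContDiff.sum fun j _ => ContDiff.mul ?_ (hw j)
  fin_cases i <;> fin_cases j <;>
    first | exact contDiff_const | exact h0.neg | exact h1.neg | exact h2.neg

/-- Restriction of jets to lower order. -/
def truncJet {m n : ℕ} (h : m ≤ n) (κ : Jet n) : Jet m := fun i => κ (Fin.castLE (by omega) i)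

theorem truncJet_invJet {m n : ℕ} (h : m ≤ n) (γ : ℝ → Fin 3 → ℝ) (x : ℝ) :
    truncJet h (invJet n γ x) = invJet m γ x := rfl

theorem contDiff_truncJet {m n : ℕ} (h : m ≤ n) : ContDiff ℝ ∞ (truncJet h) :=
  contDiff_pi.2 fun _ => contDiff_apply ..

/-- The jet of the derivative. -/
def shiftJet {n : ℕ} (κ : Jet (n + 1)) : Jet n := fun i => κ i.succ

theorem contDiff_shiftJet {n : ℕ} : ContDiff ℝ ∞ (shiftJet (n := n)) :=
  contDiff_pi.2 fun _ => contDiff_apply ..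

/-- The order n + 4 arises because k₂ already contains 𝐮''', and the jet is differentiated once
more. -/
theorem hasDerivAt_invJet {n : ℕ} {γ : ℝ → Fin 3 → ℝ} {x : ℝ}
    (hγ : ContDiffAt ℝ ((n + 4 : ℕ) : ℕ∞ω) γ x) (h : NonRadialAt γ x) :
    HasDerivAt (invJet n γ) (shiftJet (invJet (n + 1) γ x)) x := by
  rw [hasDerivAt_pi]
  intro i
  refine hasDerivAt_iteratedDeriv (contDiffAt_invariants ?_ h)
  exact hγ.of_le (by have := i.2; norm_cast; omega)

/-- The derivatives of a curve, read in the moving frame, are smooth functions of the jet of its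
invariants. -/
theorem exists_normalForm (j : ℕ) : ∃ N : Jet j → Fin 4 → ℝ, ContDiff ℝ ∞ N ∧
    ∀ (γ : ℝ → Fin 3 → ℝ) (x : ℝ), ContDiffAt ℝ ((j + 3 : ℕ) : ℕ∞ω) γ x → NonRadialAt γ x →
      rho γ x *ᵥ der γ j x = N (invJet j γ x) := by
  induction j with
  | zero =>
    refine ⟨fun _ => ![0, 0, 0, 1], contDiff_const, fun γ x _ h => ?_⟩
    rw [der_zero, rho_mulVec_lift h.1]
  | succ j ih =>
    obtain ⟨N, hN, hγN⟩ := ih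
    have ht := contDiff_truncJet (Nat.le_succ j)
    -- From (ρu^{(j)})' = K ρu^{(j)} + ρu^{(j+1)}: the next normal form is the total derivative of
    -- the previous one minus K times it.
    refine ⟨fun κ => fderiv ℝ N (truncJet (Nat.le_succ j) κ) (shiftJet κ)
      - KLof (κ 0) *ᵥ N (truncJet (Nat.le_succ j) κ), ?_, fun γ x hγ h => ?_⟩
    · refine ContDiff.sub ?_ (contDiff_KLof_mulVec (contDiff_apply ..) (hN.comp ht))
      exact ((hN.fderiv_right (m := ∞) (by simp)).comp ht).clm_apply contDiff_shiftJet
    · have hev := eventually_curve (by omega) hγ h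
      have h1 : HasDerivAt (fun y => rho γ y *ᵥ der γ j y)
          (fderiv ℝ N (invJet j γ x) (shiftJet (invJet (j + 1) γ x))) x := by
        have hNd := (hN.differentiable (by simp) (invJet j γ x)).hasFDerivAt
        have h2 := hNd.comp_hasDerivAt x
          (hasDerivAt_invJet (hγ.of_le (by norm_cast)) h)
        refine h2.congr_of_eventuallyEq (hev.mono fun y hy => ?_)
        exact hγN γ y (hy.1.of_le (by norm_cast; omega)) hy.2
      have h3 := h1.unique (hasDerivAt_mulVec
        (hasDerivAt_rho (hγ.of_le (by norm_cast; omega)) h)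
        (hasDerivAt_der (j := j) (hγ.of_le (by norm_cast; omega)) h.1))
      simp only [truncJet_invJet, KLof_invJet]
      rw [h3, ← hγN γ x (hγ.of_le (by norm_cast; omega)) h, Matrix.mulVec_mulVec]
      exact (add_sub_cancel_left _ _).symm

theorem exists_normalJet (n : ℕ) : ∃ N : Jet n → Fin (n + 1) → Fin 4 → ℝ, ContDiff ℝ ∞ N ∧
    ∀ (γ : ℝ → Fin 3 → ℝ) (x : ℝ), ContDiffAt ℝ ∞ γ x → NonRadialAt γ x →
      ∀ j : Fin (n + 1), rho γ x *ᵥ der γ j x = N (invJet n γ x) j := by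
  choose N hN hγN using exists_normalForm
  refine ⟨fun κ j => N j (truncJet (Nat.lt_succ_iff.1 j.2) κ),
    contDiff_pi.2 fun j => (hN j).comp (contDiff_truncJet _), fun γ x hγ h j => ?_⟩
  exact hγN j γ x (contDiffAt_infty.1 hγ _) h

/-! ### Invariant evolutions -/

section Invariant

variable {n : ℕ} {D : Set (Jet n)} {F : Jet n → Fin 3 → ℝ}

/-- The components of the right-hand side of an evolution in the moving frame. -/
def frameCoords (F : Jet n → Fin 3 → ℝ) (γ : ℝ → Fin 3 → ℝ) (x : ℝ) : Fin 3 → ℝ :=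
  coords (rho γ x *ᵥ dlift (γ x) (F (jet n γ x)))

/-- An invariant evolution at the jet with base frame `ρ(γ₀)` and the invariants of `γ`. -/
theorem InvariantEvolution.eq_frame_mulVec (hF : InvariantEvolution n D F)
    {γ₀ γ : ℝ → Fin 3 → ℝ} {x₀ x : ℝ} (hγ₀ : ContDiffAt ℝ 1 γ₀ x₀) (h₀ : NonRadialAt γ₀ x₀)
    (hγ : ContDiffAt ℝ ∞ γ x) (h : NonRadialAt γ x) (hD : jet n γ x ∈ D) {ι : Jet n}
    (hι : ∀ j : Fin (n + 1), coords ((rho γ₀ x₀)⁻¹ *ᵥ (rho γ x *ᵥ der γ j x)) = ι j) (hιD : ι ∈ D) :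
    F ι = frame γ₀ x₀ *ᵥ frameCoords F γ x := by
  have hγ1 : ContDiffAt ℝ 1 γ x := hγ.of_le (by exact_mod_cast le_top)
  -- This g sends γ(x) to γ₀(x₀) through the base point e₄, and carries the jet of γ to ι.
  set g := (rho γ₀ x₀)⁻¹ * rho γ x with hg
  have hgO : g ∈ O31 := mul_mem_O31 (inv_mem_O31 (rho_mem_O31 hγ₀ h₀)) (rho_mem_O31 hγ1 h)
  have hjet : jet n (fun y => Phi g (γ y)) x = ι := by
    funext j
    rw [jet, iteratedDeriv_Phi g (hγ.of_le (by exact_mod_cast le_top)) h.1, ← hι, hg,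
      Matrix.mulVec_mulVec]
  have hPhi : Phi g (γ x) = γ₀ x₀ := by
    rw [Phi, hg, ← Matrix.mulVec_mulVec, rho_mulVec_lift h.1,
      rho_inv_mulVec hγ₀ h₀ (rho_mulVec_lift h₀.1), coords_lift]
  have key := hF g hgO γ x hγ h (by rw [hPhi]; exact h₀.1) hD (by rw [hjet]; exact hιD)
  rw [hjet, fderiv_Phi_apply g h.1] at key
  rw [key, ← coords_rho_inv_tang hγ₀ h₀, frameCoords, tang_coords, hg, Matrix.mulVec_mulVec]
  -- `tang_coords` needs a vanishing first entry, which holds because the velocity is tangent to the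
  -- cone, hence orthogonal to u.
  rw [rho_mulVec_zero h.1, mink_lift_dlift h.1, neg_zero]

/-- `D` need not be stable under the group, so R cannot be read off from a cross-section inside `D`.
Instead a representative curve is chosen for each value of the invariants, and invariance makes the
choice immaterial. -/
theorem exists_invariant_components (hF : InvariantEvolution n D F) :
    ∃ R : Jet n → Fin 3 → ℝ,
      (∀ (γ : ℝ → Fin 3 → ℝ) (x : ℝ), ContDiffAt ℝ ∞ γ x → NonRadialAt γ x → jet n γ x ∈ D →
        F (jet n γ x) = frame γ x *ᵥ R (invJet n γ x)) ∧
      (IsOpen D → ContDiffOn ℝ ∞ F D → ContDiffOn ℝ ∞ R (invJets n D)) := by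
  classical
  obtain ⟨N, hN, hγN⟩ := exists_normalJet n
  have hex : ∀ κ, ∃ r : Fin 3 → ℝ, κ ∈ invJets n D → ∃ (γ : ℝ → Fin 3 → ℝ) (x : ℝ),
      ContDiffAt ℝ ∞ γ x ∧ NonRadialAt γ x ∧ jet n γ x ∈ D ∧ invJet n γ x = κ ∧
        r = frameCoords F γ x := by
    intro κ
    by_cases hκ : κ ∈ invJets n D
    · obtain ⟨γ, x, h1, h2, h3, h4⟩ := hκ
      exact ⟨_, fun _ => ⟨γ, x, h1, h2, h3, h4, rfl⟩⟩
    · exact ⟨0, fun h => absurd h hκ⟩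
  choose R hR using hex
  have hone {γ : ℝ → Fin 3 → ℝ} {x : ℝ} (hγ : ContDiffAt ℝ ∞ γ x) : ContDiffAt ℝ 1 γ x :=
    hγ.of_le (by exact_mod_cast le_top)
  have hjet {γ : ℝ → Fin 3 → ℝ} {x : ℝ} (hγ : ContDiffAt ℝ ∞ γ x) (h : NonRadialAt γ x) :
      (fun j => coords ((rho γ x)⁻¹ *ᵥ N (invJet n γ x) j)) = jet n γ x := by
    funext j
    rw [rho_inv_mulVec (hone hγ) h (hγN γ x hγ h j),
      coords_der (hγ.of_le (by exact_mod_cast le_top)) h.1, jet]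
  -- The jet is rebuilt from the invariants κ and an unrelated frame ρ(γ₀). Taking κ to be the
  -- invariants of γ₀ itself gives the first claim; fixing γ₀ and varying κ gives smoothness.
  have hmain {γ₀ : ℝ → Fin 3 → ℝ} {x₀ : ℝ} (hγ₀ : ContDiffAt ℝ ∞ γ₀ x₀)
      (h₀ : NonRadialAt γ₀ x₀) {κ : Jet n} (hκ : κ ∈ invJets n D)
      (hD : (fun j => coords ((rho γ₀ x₀)⁻¹ *ᵥ N κ j)) ∈ D) :
      F (fun j => coords ((rho γ₀ x₀)⁻¹ *ᵥ N κ j)) = frame γ₀ x₀ *ᵥ R κ := by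
    obtain ⟨γ, x, h1, h2, h3, rfl, h5⟩ := hR κ hκ
    rw [h5]
    refine hF.eq_frame_mulVec (hone hγ₀) h₀ h1 h2 h3 (fun j => ?_) hD
    rw [hγN γ x h1 h2 j]
  refine ⟨R, fun γ x hγ h hD => ?_, fun hDo hFs κ₀ hκ₀ => ?_⟩
  · have := hmain hγ h ⟨γ, x, hγ, h, hD, rfl⟩ (by rw [hjet hγ h]; exact hD)
    rwa [hjet hγ h] at this
  · obtain ⟨γ₀, x₀, hγ₀, h₀, hD₀, rfl⟩ := id hκ₀
    -- With the frame frozen at γ₀, Ψ is a smooth section sending invariants to jets, and it passes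
    -- through the given jet.
    set Ψ : Jet n → Jet n := fun κ j => coords ((rho γ₀ x₀)⁻¹ *ᵥ N κ j) with hΨ
    have hΨs : ContDiff ℝ ∞ Ψ := contDiff_pi.2 fun j =>
      (coordsL.comp (mulVecL (rho γ₀ x₀)⁻¹)).contDiff.comp (contDiff_pi.1 hN j)
    have hΨ₀ : Ψ (invJet n γ₀ x₀) = jet n γ₀ x₀ := hjet hγ₀ h₀
    have hFΨ : ContDiffAt ℝ ∞ (fun κ => F (Ψ κ)) (invJet n γ₀ x₀) := by
      refine ContDiffAt.comp _ ?_ hΨs.contDiffAt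
      rw [hΨ₀]
      exact hFs.contDiffAt (hDo.mem_nhds hD₀)
    have hlin : ContDiffAt ℝ ∞ (fun κ => coords (rho γ₀ x₀ *ᵥ dlift (γ₀ x₀) (F (Ψ κ))))
        (invJet n γ₀ x₀) := by
      have := (((coordsL.comp (mulVecL (rho γ₀ x₀))).comp
        (fderiv ℝ lift (γ₀ x₀))).contDiff (n := ∞)).contDiffAt.comp _ hFΨ
      refine this.congr_of_eventuallyEq (Filter.Eventually.of_forall fun κ => ?_)
      simp [fderiv_lift_apply h₀.1, coordsL_apply, mulVecL_apply]
    have hRe : ∀ κ ∈ invJets n D, Ψ κ ∈ D →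
        R κ = coords (rho γ₀ x₀ *ᵥ dlift (γ₀ x₀) (F (Ψ κ))) := by
      intro κ hκ hκD
      rw [hmain hγ₀ h₀ hκ hκD, rho_mulVec_dlift_frame (hone hγ₀) h₀, coords_tang]
    -- The chosen R agrees with a smooth function only at points of `invJets n D` near κ₀, which is
    -- enough for smoothness within that set.
    refine hlin.contDiffWithinAt.congr_of_eventuallyEq ?_ (hRe _ hκ₀ (by rw [hΨ₀]; exact hD₀))
    have hmem : ∀ᶠ κ in nhds (invJet n γ₀ x₀), Ψ κ ∈ D :=
      hΨs.continuous.continuousAt.eventually (by rw [hΨ₀]; exact hDo.mem_nhds hD₀)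
    filter_upwards [self_mem_nhdsWithin, mem_nhdsWithin_of_mem_nhds hmem] with κ h1 h2
    exact hRe κ h1 h2

end Invariant

/-! ### Partial derivatives of functions of two variables -/

section Partial

variable {E : Type*} [NormedAddCommGroup E] [NormedSpace ℝ E] {f : ℝ × ℝ → E} {S : Set (ℝ × ℝ)}
  {t x : ℝ}

theorem hasDerivAt_slice_snd (hf : DifferentiableAt ℝ f (t, x)) :
    HasDerivAt (fun y => f (t, y)) (fderiv ℝ f (t, x) (0, 1)) x :=
  hf.hasFDerivAt.comp_hasDerivAt x ((hasDerivAt_const x t).prodMk (hasDerivAt_id x))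

theorem hasDerivAt_slice_fst (hf : DifferentiableAt ℝ f (t, x)) :
    HasDerivAt (fun s => f (s, x)) (fderiv ℝ f (t, x) (1, 0)) t :=
  hf.hasFDerivAt.comp_hasDerivAt t ((hasDerivAt_id t).prodMk (hasDerivAt_const t x))

theorem contDiffOn_fderiv_apply (hS : IsOpen S) (hf : ContDiffOn ℝ ∞ f S) (v : ℝ × ℝ) :
    ContDiffOn ℝ ∞ (fun q => fderiv ℝ f q v) S :=
  (hf.fderiv_of_isOpen hS (by simp)).clm_apply contDiffOn_const

theorem fderiv_fderiv_apply_comm (hf : ContDiffAt ℝ ∞ f (t, x)) (v w : ℝ × ℝ) :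
    fderiv ℝ (fun q => fderiv ℝ f q v) (t, x) w = fderiv ℝ (fun q => fderiv ℝ f q w) (t, x) v := by
  have hd : DifferentiableAt ℝ (fderiv ℝ f) (t, x) :=
    (hf.fderiv_right (m := ∞) (by simp)).differentiableAt (by simp)
  have h (v w : ℝ × ℝ) :
      fderiv ℝ (fun q => fderiv ℝ f q v) (t, x) w = fderiv ℝ (fderiv ℝ f) (t, x) w v := by
    rw [fderiv_clm_apply hd (differentiableAt_const v)]
    simp
  rw [h, h]
  exact (contDiffAt_infty.1 hf 2).isSymmSndFDerivAt (by simp) w v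

theorem contDiffOn_deriv_slice (hS : IsOpen S) (hf : ContDiffOn ℝ ∞ f S) :
    ContDiffOn ℝ ∞ (fun q : ℝ × ℝ => deriv (fun y => f (q.1, y)) q.2) S :=
  (contDiffOn_fderiv_apply hS hf (0, 1)).congr fun q hq =>
    (hasDerivAt_slice_snd ((hf.contDiffAt (hS.mem_nhds hq)).differentiableAt (by simp))).deriv

theorem contDiffOn_iteratedDeriv_slice (hS : IsOpen S) (hf : ContDiffOn ℝ ∞ f S) (j : ℕ) :
    ContDiffOn ℝ ∞ (fun q : ℝ × ℝ => iteratedDeriv j (fun y => f (q.1, y)) q.2) S := by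
  induction j with
  | zero => simpa using hf
  | succ j ih =>
    simp only [iteratedDeriv_succ]
    exact contDiffOn_deriv_slice hS ih

/-- The compatibility condition of `R_x = K R` and `R_t = N R`. -/
theorem zero_curvature {R K N : ℝ × ℝ → Matrix (Fin 4) (Fin 4) ℝ}
    {Kt Nx : Matrix (Fin 4) (Fin 4) ℝ} (hS : IsOpen S)
    (hR : ∀ i j, ContDiffOn ℝ ∞ (fun q => R q i j) S)
    (hx : ∀ q ∈ S, ∀ i j, HasDerivAt (fun y => R (q.1, y) i j) ((K q * R q) i j) q.2)
    (ht : ∀ q ∈ S, ∀ i j, HasDerivAt (fun s => R (s, q.2) i j) ((N q * R q) i j) q.1)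
    (hK : ∀ i j, ContDiffOn ℝ ∞ (fun q => K q i j) S)
    (hN : ∀ i j, ContDiffOn ℝ ∞ (fun q => N q i j) S)
    (hq : (t, x) ∈ S) (hO : R (t, x) ∈ O31)
    (hKt : ∀ i j, HasDerivAt (fun s => K (s, x) i j) (Kt i j) t)
    (hNx : ∀ i j, HasDerivAt (fun y => N (t, y) i j) (Nx i j) x) :
    Kt + K (t, x) * N (t, x) = Nx + N (t, x) * K (t, x) := by
  have hdiff {f : ℝ × ℝ → ℝ} (hf : ContDiffOn ℝ ∞ f S) {q : ℝ × ℝ} (hq : q ∈ S) :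
      DifferentiableAt ℝ f q := (hf.contDiffAt (hS.mem_nhds hq)).differentiableAt (by simp)
  have hmul {a b : ℝ × ℝ → Matrix (Fin 4) (Fin 4) ℝ}
      (ha : ∀ i j, ContDiffOn ℝ ∞ (fun q => a q i j) S)
      (hb : ∀ i j, ContDiffOn ℝ ∞ (fun q => b q i j) S) (i j : Fin 4) :
      ContDiffOn ℝ ∞ (fun q => (a q * b q) i j) S := by
    simp only [Matrix.mul_apply]
    exact ContDiffOn.sum fun k _ => (ha i k).mul (hb k j)
  -- This is R_xt = R_tx after substituting the two linear equations; cancelling the invertible R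
  -- leaves the curvature condition.
  have key : Kt * R (t, x) + K (t, x) * (N (t, x) * R (t, x))
      = Nx * R (t, x) + N (t, x) * (K (t, x) * R (t, x)) := by
    ext i j
    have e1 : (fun q => fderiv ℝ (fun q => R q i j) q (0, 1)) =ᶠ[nhds (t, x)]
        fun q => (K q * R q) i j :=
      Filter.eventually_of_mem (hS.mem_nhds hq) fun q hq =>
        (hasDerivAt_slice_snd (hdiff (hR i j) hq)).unique (hx q hq i j)
    have e2 : (fun q => fderiv ℝ (fun q => R q i j) q (1, 0)) =ᶠ[nhds (t, x)]
        fun q => (N q * R q) i j :=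
      Filter.eventually_of_mem (hS.mem_nhds hq) fun q hq =>
        (hasDerivAt_slice_fst (hdiff (hR i j) hq)).unique (ht q hq i j)
    have e3 := fderiv_fderiv_apply_comm ((hR i j).contDiffAt (hS.mem_nhds hq)) (0, 1) (1, 0)
    rw [e1.fderiv_eq, e2.fderiv_eq] at e3
    have d1 := (hasDerivAt_slice_fst (hdiff (hmul hK hR i j) hq)).unique
      (hasDerivAt_matrix_mul hKt (ht _ hq) i j)
    have d2 := (hasDerivAt_slice_snd (hdiff (hmul hN hR i j) hq)).unique
      (hasDerivAt_matrix_mul hNx (hx _ hq) i j)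
    rw [d1, d2] at e3
    exact e3
  have h2 := congrArg (· * (R (t, x))⁻¹) key
  simpa [Matrix.add_mul, Matrix.mul_assoc, mul_inv_of_mem_O31 hO] using h2

end Partial

/-! ### Flows of curves -/

section Flow

variable {T X : Set ℝ} {u r : ℝ → ℝ → Fin 3 → ℝ}

namespace IsFlow

theorem contDiffAt_curve (hu : IsFlow T X u r) (hT : IsOpen T) (hX : IsOpen X) {t x : ℝ}
    (ht : t ∈ T) (hx : x ∈ X) : ContDiffAt ℝ ∞ (u t) x :=
  (hu.smooth.contDiffAt ((hT.prod hX).mem_nhds (Set.mk_mem_prod ht hx))).comp x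
    (contDiffAt_const.prodMk contDiffAt_id)

theorem contDiffOn_lift (hu : IsFlow T X u r) :
    ContDiffOn ℝ ∞ (fun q : ℝ × ℝ => lift (u q.1 q.2)) (T ×ˢ X) := fun q hq =>
  ContDiffAt.comp_contDiffWithinAt (g := lift) q
    (contDiffAt_lift (hu.nonRadial q.1 hq.1 q.2 hq.2).1) (hu.smooth q hq)

variable (hu : IsFlow T X u r) (hT : IsOpen T) (hX : IsOpen X)

include hu hT hX

theorem contDiffAt_iteratedDeriv (j : ℕ) {q : ℝ × ℝ} (hq : q ∈ T ×ˢ X) :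
    ContDiffAt ℝ ∞ (fun q : ℝ × ℝ => iteratedDeriv j (u q.1) q.2) q :=
  (contDiffOn_iteratedDeriv_slice (hT.prod hX) hu.smooth j).contDiffAt ((hT.prod hX).mem_nhds hq)

theorem contDiffAt_der (j : ℕ) {q : ℝ × ℝ} (hq : q ∈ T ×ˢ X) :
    ContDiffAt ℝ ∞ (fun q : ℝ × ℝ => der (u q.1) j q.2) q :=
  (contDiffOn_iteratedDeriv_slice (hT.prod hX) hu.contDiffOn_lift j).contDiffAt
    ((hT.prod hX).mem_nhds hq)

theorem contDiffOn_rho (i j : Fin 4) :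
    ContDiffOn ℝ ∞ (fun q : ℝ × ℝ => rho (u q.1) q.2 i j) (T ×ˢ X) := by
  intro q hq
  have h := contDiffAt_rho (m := ∞) (c := fun q : ℝ × ℝ => u q.1) (p := Prod.snd) (e := q) (hu.contDiffAt_der hT hX 1 hq)
    (fun j _ => hu.contDiffAt_iteratedDeriv hT hX j hq)
    (hu.nonRadial q.1 hq.1 q.2 hq.2) i j
  exact h.contDiffWithinAt

theorem contDiffOn_k0 : ContDiffOn ℝ ∞ (fun q : ℝ × ℝ => k0 (u q.1) q.2) (T ×ˢ X) := by
  intro q hq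
  have h := contDiffAt_k0 (m := ∞) (c := fun q : ℝ × ℝ => u q.1) (p := Prod.snd) (e := q) (hu.contDiffAt_der hT hX 1 hq)
    (hu.nonRadial q.1 hq.1 q.2 hq.2)
  exact h.contDiffWithinAt

theorem contDiffOn_k1 : ContDiffOn ℝ ∞ (fun q : ℝ × ℝ => k1 (u q.1) q.2) (T ×ˢ X) := by
  intro q hq
  have h := contDiffAt_k1 (m := ∞) (c := fun q : ℝ × ℝ => u q.1) (p := Prod.snd) (e := q) (hu.contDiffAt_der hT hX 1 hq)
    (hu.contDiffAt_der hT hX 2 hq) (hu.nonRadial q.1 hq.1 q.2 hq.2)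
  exact h.contDiffWithinAt

theorem contDiffOn_k2 : ContDiffOn ℝ ∞ (fun q : ℝ × ℝ => k2 (u q.1) q.2) (T ×ˢ X) := by
  intro q hq
  have h := contDiffAt_k2 (m := ∞) (c := fun q : ℝ × ℝ => u q.1) (p := Prod.snd) (e := q)
    (fun j _ => hu.contDiffAt_der hT hX j hq)
    (fun j _ => hu.contDiffAt_iteratedDeriv hT hX j hq)
    (hu.nonRadial q.1 hq.1 q.2 hq.2)
  exact h.contDiffWithinAt

theorem contDiffAt_one {q : ℝ × ℝ} (hq : q ∈ T ×ˢ X) : ContDiffAt ℝ 1 (u q.1) q.2 :=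
  (hu.contDiffAt_curve hT hX hq.1 hq.2).of_le (by exact_mod_cast le_top)

theorem rho_mem {q : ℝ × ℝ} (hq : q ∈ T ×ˢ X) : rho (u q.1) q.2 ∈ O31 :=
  rho_mem_O31 (hu.contDiffAt_one hT hX hq) (hu.nonRadial _ hq.1 _ hq.2)

/-- In the frame the evolution equation is solved for r, so smoothness of r is a consequence of that
of u and need not be assumed. -/
theorem rho_mulVec_fderiv_lift {q : ℝ × ℝ} (hq : q ∈ T ×ˢ X) :
    rho (u q.1) q.2 *ᵥ fderiv ℝ (fun q : ℝ × ℝ => lift (u q.1 q.2)) q (1, 0)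
      = tang (r q.1 q.2) := by
  have h := hu.nonRadial q.1 hq.1 q.2 hq.2
  have h1 := hasDerivAt_lift (hu.evolves q.1 hq.1 q.2 hq.2) h.1
  have h2 := hasDerivAt_slice_fst (f := fun q : ℝ × ℝ => lift (u q.1 q.2)) (t := q.1) (x := q.2)
    ((hu.contDiffOn_lift.contDiffAt ((hT.prod hX).mem_nhds hq)).differentiableAt (by simp))
  rw [h2.unique h1, rho_mulVec_dlift_frame (hu.contDiffAt_one hT hX hq) h]

/-- The components of the velocity in the moving frame are smooth. -/
theorem contDiffOn_components : ContDiffOn ℝ ∞ (fun q : ℝ × ℝ => r q.1 q.2) (T ×ˢ X) := by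
  have h1 := contDiffOn_fderiv_apply (hT.prod hX) hu.contDiffOn_lift (1, 0)
  have h2 : ContDiffOn ℝ ∞ (fun q : ℝ × ℝ => rho (u q.1) q.2 *ᵥ
      fderiv ℝ (fun q : ℝ × ℝ => lift (u q.1 q.2)) q (1, 0)) (T ×ˢ X) := by
    rw [contDiffOn_pi] at h1 ⊢
    intro i
    simp only [Matrix.mulVec, dotProduct]
    exact ContDiffOn.sum fun j _ => (hu.contDiffOn_rho hT hX i j).mul (h1 j)
  refine (coordsL.contDiff.comp_contDiffOn h2).congr fun q hq => ?_
  rw [Function.comp_apply, hu.rho_mulVec_fderiv_lift hT hX hq, coordsL_apply, coords_tang]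

/-- The matrix `ρ_t ρ⁻¹` of a flow. -/
theorem exists_velocity : ∃ N : ℝ × ℝ → Matrix (Fin 4) (Fin 4) ℝ,
    (∀ i j, ContDiffOn ℝ ∞ (fun q => N q i j) (T ×ˢ X)) ∧
    (∀ q ∈ T ×ˢ X, ∀ i j,
      HasDerivAt (fun s => rho (u s) q.2 i j) ((N q * rho (u q.1) q.2) i j) q.1) ∧
    (∀ q ∈ T ×ˢ X, N q = !![r q.1 q.2 2, -r q.1 q.2 0, -r q.1 q.2 1, 0;
        N q 3 1, 0, -N q 2 1, -r q.1 q.2 0;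
        N q 2 0, N q 2 1, 0, -r q.1 q.2 1;
        0, N q 3 1, N q 2 0, -r q.1 q.2 2]) := by
  set Rt : ℝ × ℝ → Matrix (Fin 4) (Fin 4) ℝ := fun q =>
    Matrix.of fun i j => fderiv ℝ (fun q : ℝ × ℝ => rho (u q.1) q.2 i j) q (1, 0) with hRt
  have hS := hT.prod hX
  have hdR {q : ℝ × ℝ} (hq : q ∈ T ×ˢ X) (i j : Fin 4) :
      HasDerivAt (fun s => rho (u s) q.2 i j) (Rt q i j) q.1 :=
    hasDerivAt_slice_fst (f := fun q : ℝ × ℝ => rho (u q.1) q.2 i j) (t := q.1) (x := q.2)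
      (((hu.contDiffOn_rho hT hX i j).contDiffAt (hS.mem_nhds hq)).differentiableAt (by simp))
  have hNt : ∀ q ∈ T ×ˢ X, ∀ i j, HasDerivAt (fun s => rho (u s) q.2 i j)
      ((Rt q * (rho (u q.1) q.2)⁻¹ * rho (u q.1) q.2) i j) q.1 := by
    intro q hq i j
    rw [Matrix.mul_assoc, inv_mul_of_mem_O31 (hu.rho_mem hT hX hq), Matrix.mul_one]
    exact hdR hq i j
  obtain ⟨N, hN⟩ : ∃ N : ℝ × ℝ → Matrix (Fin 4) (Fin 4) ℝ,
      ∀ q, N q = Rt q * (rho (u q.1) q.2)⁻¹ := ⟨_, fun _ => rfl⟩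
  simp only [← hN] at hNt
  refine ⟨N, fun i j => ?_, hNt, fun q hq => ?_⟩
  -- On T × X the inverse frame is JρᵀJ, whose entries are smooth.
  · have h1 : ContDiffOn ℝ ∞ (fun q : ℝ × ℝ => (Rt q * (J * (rho (u q.1) q.2)ᵀ * J)) i j)
        (T ×ˢ X) := by
      simp only [Matrix.mul_apply, Matrix.transpose_apply]
      exact ContDiffOn.sum fun k _ =>
        (contDiffOn_fderiv_apply hS (hu.contDiffOn_rho hT hX i k) (1, 0)).mul
          (ContDiffOn.sum fun l _ => (ContDiffOn.sum fun m _ =>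
            contDiffOn_const.mul (hu.contDiffOn_rho hT hX l m)).mul contDiffOn_const)
    refine h1.congr fun q hq => ?_
    rw [hN, inv_eq_of_mem_O31 (hu.rho_mem hT hX hq)]
  · have hO : ∀ᶠ s in nhds q.1, rho (u s) q.2 ∈ O31 :=
      Filter.eventually_of_mem (hT.mem_nhds hq.1) fun s hs =>
        hu.rho_mem hT hX (q := (s, q.2)) ⟨hs, hq.2⟩
    have hskew := eq_of_mink_skew (mink_skew_of_hasDerivAt hO (hNt q hq))
    have hL := hasDerivAt_slice_fst (f := fun q : ℝ × ℝ => lift (u q.1 q.2)) (t := q.1) (x := q.2)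
      ((hu.contDiffOn_lift.contDiffAt (hS.mem_nhds hq)).differentiableAt (by simp))
    -- The time derivative of ρu = e₄ reads N e₄ + (0, r₁, r₂, r₃) = 0.
    have h1 := (hasDerivAt_mulVec (hNt q hq) hL).unique
      ((hasDerivAt_const q.1 ![0, 0, 0, 1]).congr_of_eventuallyEq
        (Filter.eventually_of_mem (hT.mem_nhds hq.1) fun s hs =>
          rho_mulVec_lift (hu.nonRadial s hs q.2 hq.2).1))
    rw [← Matrix.mulVec_mulVec, rho_mulVec_lift (hu.nonRadial q.1 hq.1 q.2 hq.2).1,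
      hu.rho_mulVec_fderiv_lift hT hX hq] at h1
    have n13 := congrFun h1 1
    have n23 := congrFun h1 2
    have n33 := congrFun h1 3
    simp [Matrix.mulVec, dotProduct, Fin.sum_univ_four, tang] at n13 n23 n33
    have m13 : N q 1 3 = -r q.1 q.2 0 := by linarith
    have m23 : N q 2 3 = -r q.1 q.2 1 := by linarith
    have m33 : N q 3 3 = -r q.1 q.2 2 := by linarith
    rw [m13, m23, m33, neg_neg] at hskew
    exact hskew

end IsFlow

end Flow

/-! ### The evolution of the invariants -/

section Evolution

variable {T X : Set ℝ} {u r : ℝ → ℝ → Fin 3 → ℝ}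

namespace IsFlow

/-- The entries of the zero-curvature equation of a flow: `σ, c₁, c₂` are the entries of the
velocity matrix that are not determined by the components of the velocity. -/
theorem exists_structure_equations (hu : IsFlow T X u r) (hT : IsOpen T) (hX : IsOpen X) :
    ∃ σ c₁ c₂ : ℝ → ℝ → ℝ, ∀ t ∈ T, ∀ x ∈ X,
      HasDerivAt (fun s => k0 (u s) x)
        (deriv (fun y => r t y 0) x + r t x 2 * k0 (u t) x) t ∧
      σ t x = -(1 / k0 (u t) x * deriv (fun y => r t y 1) x) ∧
      c₁ t x = -(1 / k0 (u t) x *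
        (k1 (u t) x * r t x 0 + k2 (u t) x * r t x 1 + deriv (fun y => r t y 2) x)) ∧
      c₂ t x = -(1 / k0 (u t) x *
        (deriv (fun y => -σ t y) x + k2 (u t) x * r t x 0 - k1 (u t) x * r t x 1)) ∧
      HasDerivAt (fun s => k1 (u s) x)
        (deriv (fun y => -c₁ t y) x - k1 (u t) x * r t x 2 - k2 (u t) x * σ t x) t ∧
      HasDerivAt (fun s => k2 (u s) x)
        (deriv (fun y => -c₂ t y) x - k2 (u t) x * r t x 2 + k1 (u t) x * σ t x) t := by
  obtain ⟨N, hNs, hNt, hNe⟩ := hu.exists_velocity hT hX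
  have hS := hT.prod hX
  refine ⟨fun t x => N (t, x) 2 1, fun t x => N (t, x) 3 1, fun t x => N (t, x) 2 0,
    fun t ht x hx => ?_⟩
  have hq : (t, x) ∈ T ×ˢ X := ⟨ht, hx⟩
  have hdiff {f : ℝ × ℝ → ℝ} (hf : ContDiffOn ℝ ∞ f (T ×ˢ X)) : DifferentiableAt ℝ f (t, x) :=
    (hf.contDiffAt (hS.mem_nhds hq)).differentiableAt (by simp)
  have hslice {f : ℝ × ℝ → ℝ} (hf : ContDiffOn ℝ ∞ f (T ×ˢ X)) :
      HasDerivAt (fun y => f (t, y)) (deriv (fun y => f (t, y)) x) x :=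
    (hasDerivAt_slice_snd (hdiff hf)).differentiableAt.hasDerivAt
  have hr (i : Fin 3) : HasDerivAt (fun y => r t y i) (deriv (fun y => r t y i) x) x :=
    hslice (contDiffOn_pi.1 (hu.contDiffOn_components hT hX) i)
  have hn (i j : Fin 4) : HasDerivAt (fun y => N (t, y) i j) (deriv (fun y => N (t, y) i j) x) x :=
    hslice (hNs i j)
  have hk0 := hasDerivAt_slice_fst (hdiff (hu.contDiffOn_k0 hT hX))
  have hk1 := hasDerivAt_slice_fst (hdiff (hu.contDiffOn_k1 hT hX))
  have hk2 := hasDerivAt_slice_fst (hdiff (hu.contDiffOn_k2 hT hX))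
  set k0t := fderiv ℝ (fun q : ℝ × ℝ => k0 (u q.1) q.2) (t, x) (1, 0)
  set k1t := fderiv ℝ (fun q : ℝ × ℝ => k1 (u q.1) q.2) (t, x) (1, 0)
  set k2t := fderiv ℝ (fun q : ℝ × ℝ => k2 (u q.1) q.2) (t, x) (1, 0)
  set r0x := deriv (fun y => r t y 0) x
  set r1x := deriv (fun y => r t y 1) x
  set r2x := deriv (fun y => r t y 2) x
  have hKs (i j : Fin 4) : ContDiffOn ℝ ∞ (fun q : ℝ × ℝ => KL (u q.1) q.2 i j) (T ×ˢ X) := by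
    have h0 := hu.contDiffOn_k0 hT hX
    have h1 := hu.contDiffOn_k1 hT hX
    have h2 := hu.contDiffOn_k2 hT hX
    fin_cases i <;> fin_cases j <;>
      first | exact contDiffOn_const | exact h0.neg | exact h1.neg | exact h2.neg
  have hKt (i j : Fin 4) : HasDerivAt (fun s => KL (u s) x i j)
      ((!![0, -k0t, 0, 0; -k1t, 0, 0, -k0t; -k2t, 0, 0, 0; 0, -k1t, -k2t, 0] :
        Matrix (Fin 4) (Fin 4) ℝ) i j) t := by
    fin_cases i <;> fin_cases j <;>
      first | exact hasDerivAt_const t (0 : ℝ) | exact hk0.neg | exact hk1.neg | exact hk2.neg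
  have hNx (i j : Fin 4) : HasDerivAt (fun y => N (t, y) i j)
      ((!![r2x, -r0x, -r1x, 0;
          deriv (fun y => N (t, y) 3 1) x, 0, -deriv (fun y => N (t, y) 2 1) x, -r0x;
          deriv (fun y => N (t, y) 2 0) x, deriv (fun y => N (t, y) 2 1) x, 0, -r1x;
          0, deriv (fun y => N (t, y) 3 1) x, deriv (fun y => N (t, y) 2 0) x, -r2x] :
        Matrix (Fin 4) (Fin 4) ℝ) i j) x := by
    -- The structured form of N holds on all of T × X, so N_x inherits the same pattern.
    have hev : (fun y => N (t, y) i j) =ᶠ[nhds x] fun y => _ :=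
      Filter.eventually_of_mem (hX.mem_nhds hx) fun y hy =>
        congrFun (congrFun (hNe (t, y) ⟨ht, hy⟩) i) j
    refine HasDerivAt.congr_of_eventuallyEq ?_ hev
    fin_cases i <;> fin_cases j <;>
      first
        | exact hasDerivAt_const x (0 : ℝ) | exact hr 2 | exact (hr 0).neg | exact (hr 1).neg
        | exact (hr 2).neg | exact hn 3 1 | exact hn 2 0 | exact hn 2 1 | exact (hn 2 1).neg
  have zc := zero_curvature (R := fun q => rho (u q.1) q.2) (K := fun q => KL (u q.1) q.2) hS
    (hu.contDiffOn_rho hT hX)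
    (fun q hq i j => hasDerivAt_rho
      (contDiffAt_infty.1 (hu.contDiffAt_curve hT hX hq.1 hq.2) 3) (hu.nonRadial _ hq.1 _ hq.2) i j)
    hNt hKs hNs hq (hu.rho_mem hT hX hq) hKt hNx
  rw [hNe _ hq] at zc
  have z (i j : Fin 4) := congrFun (congrFun zc i) j
  -- Entries (2,3), (3,3), (2,1) solve algebraically for σ, c₁, c₂, as k₀ ≠ 0. Entries (1,3), (3,1),
  -- (2,0) contain the time derivatives of k₀, k₁, k₂.
  have z13 := z 1 3
  have z23 := z 2 3
  have z33 := z 3 3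
  have z21 := z 2 1
  have z31 := z 3 1
  have z20 := z 2 0
  simp [KL] at z13 z23 z33 z21 z31 z20
  have hk : k0 (u t) x ≠ 0 := (k0_pos (hu.nonRadial t ht x hx)).ne'
  refine ⟨hk0.congr_deriv (by linarith), ?_, ?_, ?_, hk1.congr_deriv ?_, hk2.congr_deriv ?_⟩
  · field_simp
    linarith
  · field_simp
    linarith
  · rw [deriv.fun_neg]
    field_simp
    linarith
  · rw [deriv.fun_neg]
    linarith
  · rw [deriv.fun_neg]
    linarith

/-- The formulas for σ, c₁, c₂ are substituted into the structure equations. They hold on all of X,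
which permits substitution under the x-derivative; for k₂ this happens twice, since c₂ contains σ'.
-/
theorem hasDerivAt_invariants (hu : IsFlow T X u r) (hT : IsOpen T) (hX : IsOpen X) {t x : ℝ}
    (ht : t ∈ T) (hx : x ∈ X) :
    HasDerivAt (fun s => k0 (u s) x)
      (deriv (fun y => r t y 0) x + r t x 2 * k0 (u t) x) t ∧
    HasDerivAt (fun s => k1 (u s) x)
      (deriv (fun y => 1 / k0 (u t) y *
          (k1 (u t) y * r t y 0 + k2 (u t) y * r t y 1 + deriv (fun z => r t z 2) y)) x
        - k1 (u t) x * r t x 2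
        + k2 (u t) x / k0 (u t) x * deriv (fun y => r t y 1) x) t ∧
    HasDerivAt (fun s => k2 (u s) x)
      (deriv (fun y => 1 / k0 (u t) y *
          (deriv (fun z => 1 / k0 (u t) z * deriv (fun w => r t w 1) z) y
            + k2 (u t) y * r t y 0 - k1 (u t) y * r t y 1)) x
        - k2 (u t) x * r t x 2
        - k1 (u t) x / k0 (u t) x * deriv (fun y => r t y 1) x) t := by
  obtain ⟨σ, c₁, c₂, h⟩ := hu.exists_structure_equations hT hX
  obtain ⟨h0, hs, -, -, h1, h2⟩ := h t ht x hx
  have near {y : ℝ} (hy : y ∈ X) {P : ℝ → Prop} (hP : ∀ z ∈ X, P z) : ∀ᶠ z in nhds y, P z :=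
    Filter.eventually_of_mem (hX.mem_nhds hy) hP
  refine ⟨h0, h1.congr_deriv ?_, h2.congr_deriv ?_⟩
  · rw [Filter.EventuallyEq.deriv_eq (near hx fun y hy => by
      rw [(h t ht y hy).2.2.1, neg_neg]), hs]
    ring
  · rw [Filter.EventuallyEq.deriv_eq (near hx fun y hy => by
      rw [(h t ht y hy).2.2.2.1, neg_neg, Filter.EventuallyEq.deriv_eq (near hy fun z hz => by
        rw [(h t ht z hz).2.1, neg_neg])]), hs]
    ring

/-- The condition says that (k₀)_t = r₁' + r₃k₀ vanishes. Connectedness of T is what passes from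
zero time derivative to constancy. -/
theorem preservesArcLength_iff (hu : IsFlow T X u r) (hT : IsOpen T) (hTc : T.OrdConnected)
    (hX : IsOpen X) :
    PreservesArcLength T X u ↔
      ∀ t ∈ T, ∀ x ∈ X, r t x 2 = -(deriv (fun y => r t y 0) x) / k0 (u t) x := by
  have hd (t : ℝ) (ht : t ∈ T) (x : ℝ) (hx : x ∈ X) := (hu.hasDerivAt_invariants hT hX ht hx).1
  constructor
  · intro h t ht x hx
    have h1 := (hd t ht x hx).unique ((hasDerivAt_const t (k0 (u t) x)).congr_of_eventuallyEq
      (Filter.eventually_of_mem (hT.mem_nhds ht) fun s hs => h s hs t ht x hx))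
    rw [eq_div_iff (k0_pos (hu.nonRadial t ht x hx)).ne']
    linarith
  · intro h s hs t ht x hx
    refine hT.is_const_of_deriv_eq_zero hTc.isPreconnected
      (fun t ht => (hd t ht x hx).differentiableAt.differentiableWithinAt) (fun t ht => ?_) hs ht
    rw [(hd t ht x hx).deriv, h t ht x hx,
      div_mul_cancel₀ _ (k0_pos (hu.nonRadial t ht x hx)).ne']
    simp

/-- Arc-length preservation propagates k₀ = 1 to every time. Then r₃' = -r₁'' produces -D³ in the k₁
equation, while D³ in the k₂ equation comes from (r₂'')'. -/
theorem hasDerivAt_curvatures_of_unit_speed (hu : IsFlow T X u r) (hT : IsOpen T)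
    (hTc : T.OrdConnected) (hX : IsOpen X) (hp : PreservesArcLength T X u)
    (h1 : ∃ t₀ ∈ T, ∀ x ∈ X, k0 (u t₀) x = 1) {t x : ℝ} (ht : t ∈ T) (hx : x ∈ X) :
    k0 (u t) x = 1 ∧ r t x 2 = -(deriv (fun y => r t y 0) x) ∧
      HasDerivAt (fun s => (k1 (u s) x, k2 (u s) x))
        (opP (k1 (u t)) (k2 (u t)) (fun y => r t y 0) (fun y => r t y 1) x) t := by
  obtain ⟨t₀, ht₀, h1⟩ := h1
  have hk (y : ℝ) (hy : y ∈ X) : k0 (u t) y = 1 := (hp t ht t₀ ht₀ y hy).trans (h1 y hy)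
  have hr2 (y : ℝ) (hy : y ∈ X) : r t y 2 = -(deriv (fun z => r t z 0) y) := by
    rw [(hu.preservesArcLength_iff hT hTc hX).1 hp t ht y hy, hk y hy, div_one]
  refine ⟨hk x hx, hr2 x hx, ?_⟩
  have hS := hT.prod hX
  have near {y : ℝ} (hy : y ∈ X) {P : ℝ → Prop} (hP : ∀ z ∈ X, P z) : ∀ᶠ z in nhds y, P z :=
    Filter.eventually_of_mem (hX.mem_nhds hy) hP
  have hsl {f : ℝ × ℝ → ℝ} (hf : ContDiffOn ℝ ∞ f (T ×ˢ X)) :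
      ContDiffAt ℝ ∞ (fun y => f (t, y)) x :=
    (hf.contDiffAt (hS.mem_nhds ⟨ht, hx⟩)).comp x (contDiffAt_const.prodMk contDiffAt_id)
  have hd {f : ℝ → ℝ} (hf : ContDiffAt ℝ ∞ f x) : DifferentiableAt ℝ f x :=
    hf.differentiableAt (by simp)
  have hr (i : Fin 3) : ContDiffAt ℝ ∞ (fun y => r t y i) x :=
    hsl (contDiffOn_pi.1 (hu.contDiffOn_components hT hX) i)
  have hk1 : ContDiffAt ℝ ∞ (k1 (u t)) x := hsl (hu.contDiffOn_k1 hT hX)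
  have hk2 : ContDiffAt ℝ ∞ (k2 (u t)) x := hsl (hu.contDiffOn_k2 hT hX)
  have hdd (i : Fin 3) : ContDiffAt ℝ ∞ (deriv (deriv fun y => r t y i)) x :=
    contDiffAt_deriv (m := ∞) (contDiffAt_deriv (m := ∞) (hr i) (by simp)) (by simp)
  have h3 (f : ℝ → ℝ) : iteratedDeriv 3 f x = deriv (deriv (deriv f)) x := by
    rw [iteratedDeriv_succ, iteratedDeriv_succ, iteratedDeriv_one]
  obtain ⟨-, e1, e2⟩ := hu.hasDerivAt_invariants hT hX ht hx
  refine (e1.congr_deriv ?_).prodMk (e2.congr_deriv ?_)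
  -- The derivative is taken only after k₀ = 1 and r₃ = -r₁' have been inserted on a neighbourhood
  -- of x, which removes the quotients.
  · have ev : (fun y => 1 / k0 (u t) y *
          (k1 (u t) y * r t y 0 + k2 (u t) y * r t y 1 + deriv (fun z => r t z 2) y)) =ᶠ[nhds x]
        fun y => k1 (u t) y * r t y 0 + k2 (u t) y * r t y 1
          + -deriv (deriv fun z => r t z 0) y :=
      near hx fun y hy => by
        dsimp only
        rw [hk y hy, Filter.EventuallyEq.deriv_eq (near hy hr2), deriv.fun_neg]
        ring
    have d := (((hd hk1).fun_mul (hd (hr 0))).hasDerivAt.fun_add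
      ((hd hk2).fun_mul (hd (hr 1))).hasDerivAt).fun_add
      (hd (hdd 0)).hasDerivAt.fun_neg
    rw [ev.deriv_eq, HasDerivAt.deriv d, hr2 x hx, hk x hx, h3]
    ring
  · have ev : (fun y => 1 / k0 (u t) y *
          (deriv (fun z => 1 / k0 (u t) z * deriv (fun w => r t w 1) z) y
            + k2 (u t) y * r t y 0 - k1 (u t) y * r t y 1)) =ᶠ[nhds x]
        fun y => deriv (deriv fun z => r t z 1) y + k2 (u t) y * r t y 0
          - k1 (u t) y * r t y 1 :=
      near hx fun y hy => by
        dsimp only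
        rw [hk y hy, Filter.EventuallyEq.deriv_eq (near hy fun z hz => by
          rw [hk z hz, div_one, one_mul])]
        ring
    have d := ((hd (hdd 1)).hasDerivAt.fun_add ((hd hk2).fun_mul (hd (hr 0))).hasDerivAt).fun_sub
      ((hd hk1).fun_mul (hd (hr 1))).hasDerivAt
    rw [ev.deriv_eq, HasDerivAt.deriv d, hr2 x hx, hk x hx, h3]
    ring

end IsFlow

end Evolution

end LightCone

end

theorem mainTheorem7 :
    -- The explicit matrices: `ρ_L` is the Lorentz matrix given by the normalization equations,
    -- `K_L = (ρ_L)_x ρ_L⁻¹`, and `dΦ_{ρ_L⁻¹}(o)` is the explicit matrix built from `A` and `ξ`.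
    (∀ (γ : ℝ → Fin 3 → ℝ) (x : ℝ), ContDiffAt ℝ ∞ γ x → LightCone.NonRadialAt γ x →
      LightCone.rho γ x ∈ LightCone.O31 ∧
      LightCone.rho γ x *ᵥ LightCone.der γ 0 x = ![0, 0, 0, 1] ∧
      LightCone.rho γ x *ᵥ LightCone.der γ 1 x = ![0, LightCone.k0 γ x, 0, 0] ∧
      (LightCone.rho γ x *ᵥ LightCone.der γ 2 x) 2 = 0 ∧
      (∀ i j, HasDerivAt (fun y => LightCone.rho γ y i j)
        ((LightCone.KL γ x * LightCone.rho γ x) i j) x) ∧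
      LightCone.Phi (LightCone.rho γ x)⁻¹ LightCone.base = γ x ∧
      HasFDerivAt (LightCone.Phi (LightCone.rho γ x)⁻¹)
        (LinearMap.toContinuousLinearMap (Matrix.toLin' (LightCone.frame γ x)))
        LightCone.base) ∧
    -- Every invariant evolution has the stated form.
    (∀ (n : ℕ) (D : Set (LightCone.Jet n)) (F : LightCone.Jet n → Fin 3 → ℝ),
      LightCone.InvariantEvolution n D F →
      ∃ R : LightCone.Jet n → Fin 3 → ℝ,
        (∀ (γ : ℝ → Fin 3 → ℝ) (x : ℝ), ContDiffAt ℝ ∞ γ x → LightCone.NonRadialAt γ x →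
          LightCone.jet n γ x ∈ D →
          F (LightCone.jet n γ x) = LightCone.frame γ x *ᵥ R (LightCone.invJet n γ x)) ∧
        (IsOpen D → ContDiffOn ℝ ∞ F D → ContDiffOn ℝ ∞ R (LightCone.invJets n D))) ∧
    -- Arc-length and the induced evolution of the invariants.
    (∀ (T X : Set ℝ) (u r : ℝ → ℝ → Fin 3 → ℝ), IsOpen T → T.OrdConnected → IsOpen X →
      LightCone.IsFlow T X u r →
      ContDiffOn ℝ ∞ (fun q : ℝ × ℝ => r q.1 q.2) (T ×ˢ X) ∧
      (LightCone.PreservesArcLength T X u ↔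
        ∀ t ∈ T, ∀ x ∈ X, r t x 2 = -(deriv (fun y => r t y 0) x) / LightCone.k0 (u t) x) ∧
      (∀ t ∈ T, ∀ x ∈ X,
        HasDerivAt (fun s => LightCone.k0 (u s) x)
          (deriv (fun y => r t y 0) x + r t x 2 * LightCone.k0 (u t) x) t ∧
        HasDerivAt (fun s => LightCone.k1 (u s) x)
          (deriv (fun y => 1 / LightCone.k0 (u t) y *
              (LightCone.k1 (u t) y * r t y 0 + LightCone.k2 (u t) y * r t y 1
                + deriv (fun z => r t z 2) y)) x
            - LightCone.k1 (u t) x * r t x 2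
            + LightCone.k2 (u t) x / LightCone.k0 (u t) x * deriv (fun y => r t y 1) x) t ∧
        HasDerivAt (fun s => LightCone.k2 (u s) x)
          (deriv (fun y => 1 / LightCone.k0 (u t) y *
              (deriv (fun z => 1 / LightCone.k0 (u t) z * deriv (fun w => r t w 1) z) y
                + LightCone.k2 (u t) y * r t y 0 - LightCone.k1 (u t) y * r t y 1)) x
            - LightCone.k2 (u t) x * r t x 2
            - LightCone.k1 (u t) x / LightCone.k0 (u t) x * deriv (fun y => r t y 1) x) t) ∧
      (LightCone.PreservesArcLength T X u →
        (∃ t₀ ∈ T, ∀ x ∈ X, LightCone.k0 (u t₀) x = 1) →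
        ∀ t ∈ T, ∀ x ∈ X,
          LightCone.k0 (u t) x = 1 ∧
          r t x 2 = -(deriv (fun y => r t y 0) x) ∧
          HasDerivAt (fun s => (LightCone.k1 (u s) x, LightCone.k2 (u s) x))
            (LightCone.opP (LightCone.k1 (u t)) (LightCone.k2 (u t))
              (fun y => r t y 0) (fun y => r t y 1) x) t)) := by
  refine ⟨fun γ x hγ h => ?_, fun n D F hF => LightCone.exists_invariant_components hF,
    fun T X u r hT hTc hX hu => ⟨hu.contDiffOn_components hT hX,
      hu.preservesArcLength_iff hT hTc hX,
      fun t ht x hx => hu.hasDerivAt_invariants hT hX ht hx,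
      fun hp h1 t ht x hx => hu.hasDerivAt_curvatures_of_unit_speed hT hTc hX hp h1 ht hx⟩⟩
  have h1 : ContDiffAt ℝ 1 γ x := contDiffAt_infty.1 hγ 1
  refine ⟨LightCone.rho_mem_O31 h1 h, ?_, LightCone.rho_mulVec_der_one h1 h,
    LightCone.rho_mulVec_der_two_two (contDiffAt_infty.1 hγ 2) h,
    LightCone.hasDerivAt_rho (contDiffAt_infty.1 hγ 3) h, LightCone.Phi_rho_inv_base h1 h,
    LightCone.hasFDerivAt_Phi_rho_inv h1 h⟩
  rw [LightCone.der_zero, LightCone.rho_mulVec_lift h.1]
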